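/- **Setting.** Let $S$ be a compact smooth manifold of dimension $m\ge 1$ with a smooth Riemannian metric $G=(G_{AB})$, with volume measure and Laplace operator $\Delta$ taken with respect to $G$. Let $n\ge 2$ be an integer, $\alpha_M>0$, and let $V,\Lambda,\tilde\kappa\in\mathbb R$. Put $$a_0=\frac{2n(n-1)}{\alpha_M},\qquad \bar V=\frac{\alpha_M}{n(n-1)}V,\qquad \bar\Lambda=\frac{2}{n(n-1)}\Lambda .$$ Let $\mathcal H_0\subset L^2(S,\mathbb C)$ be the subspace spanned by the eigenspaces of $-\Delta$ belonging to those eigenvalues $\mu$ for which $$\bar\mu=\tfrac{4}{n^2}a_0\mu-\tfrac{(m-1)^2}{4}\le 0 .$$ For an open interval $I\subset(0,\infty)$ let $L^2(I,1)$ be the Hilbert space of complex functions $u$ on $I$ with $\int_I r|u|^2\,dr<\infty$, and let $L^2(I,1)\otimes\mathcal H_0$ be the Hilbert space tensor product. On $C_c^\infty(I)\otimes\mathcal H_0$ consider the Hamilton operator $$H\psi=r^{-1}\frac{\partial}{\partial r}\Big(r\frac{\partial\psi}{\partial r}\Big)+r^{-2}\Big(-\frac4{n^2}a_0\Delta\psi-\frac{(m-1)^2}{4}\psi\Big)+\frac{16}{n^2}(\bar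 V+\bar\Lambda)r^2\psi-\frac{16}{n^2}\tilde\kappa\, r^{\frac{2(n-2)}{n}}\psi .$$ We say that *$H$ is selfadjoint in $L^2(I,1)\otimes\mathcal H_0$* if $H$, on $C_c^\infty(I)\otimes\mathcal H_0$, is a well-defined, densely defined, symmetric operator that is bounded above, $\langle H\psi,\psi\rangle\le c\|\psi\|^2$, and its Friedrichs extension extends it and is selfadjoint. Here the Friedrichs extension is the operator $\psi\mapsto H\psi$ with domain the set of all $\psi\in L^2(I,1)\otimes\mathcal H_0$ such that * $\psi$ belongs to the form domain of $H$: there are $\varphi_k\in C_c^\infty(I)\otimes\mathcal H_0$ with $\varphi_k\to\psi$ and $\langle H(\varphi_j-\varphi_k),\varphi_j-\varphi_k\rangle\to0$ as $j,k\to\infty$; and * $H\psi\in L^2(I,1)\otimes\mathcal H_0$ in the distributional sense: there is $\chi=:H\psi$ in this space with $\langle\psi,H\varphi\rangle=\langle\chi,\varphi\rangle$ for all $\varphi\in C_c^\infty(I)\otimes\mathcal H_0$. **Theorem 1.4.** The Hamilton operator $H$ is selfadjoint in $L^2((0,r_0),1)\otimes\mathcal H_0$ for every $r_0>0$ and arbitrary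 values of $\bar V$, $\bar\Lambda$ and $\tilde\kappa$. It is also selfadjoint in $L^2((0,\infty),1)\otimes\mathcal H_0$ if $$\bar V+\bar\Lambda\le0\quad\text{and}\quad\tilde\kappa\ge0,$$ or if $$\bar V+\bar\Lambda<0\quad\text{and}\quad\tilde\kappa\ \text{is arbitrary}.$$ -/

import Mathlib

open MeasureTheory Set Filter Topology
open scoped Manifold ContDiff TensorProduct InnerProductSpace

namespace FriedmanQC

noncomputable section

/-! ### Compact Riemannian manifolds: volume measure and Laplace operator -/

section Matter

variable {m : ℕ} {S : Type*} [TopologicalSpace S] [ChartedSpace (EuclideanSpace ℝ (Fin m)) S]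

/-- A smooth Riemannian metric on the `m`-dimensional manifold `S`. -/
abbrev Metric (m : ℕ) (S : Type*) [TopologicalSpace S]
    [ChartedSpace (EuclideanSpace ℝ (Fin m)) S] [IsManifold (𝓡 m) ∞ S] :=
  Bundle.ContMDiffRiemannianMetric (𝓡 m) ∞ (EuclideanSpace ℝ (Fin m))
    (fun y : S => TangentSpace (𝓡 m) y)

/-- The coordinate vector field `∂/∂y^A` of the chart around `x₀`, at the point with
coordinates `z`. -/
def coordVec (x₀ : S) (z : EuclideanSpace ℝ (Fin m)) (A : Fin m) :
    TangentSpace (𝓡 m) ((extChartAt (𝓡 m) x₀).symm z) :=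
  mfderiv 𝓘(ℝ, EuclideanSpace ℝ (Fin m)) (𝓡 m) (extChartAt (𝓡 m) x₀).symm z
    (EuclideanSpace.single A (1 : ℝ))

variable [IsManifold (𝓡 m) ∞ S]

/-- The matrix `(G_{AB})` of the metric in the chart around `x₀`. -/
def metricMatrix (G : Metric m S) (x₀ : S) (z : EuclideanSpace ℝ (Fin m)) :
    Matrix (Fin m) (Fin m) ℝ :=
  Matrix.of fun A B =>
    G.inner ((extChartAt (𝓡 m) x₀).symm z) (coordVec x₀ z A) (coordVec x₀ z B)

/-- The density `√det (G_{AB})` in the chart around `x₀`. -/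
def volDensity (G : Metric m S) (x₀ : S) (z : EuclideanSpace ℝ (Fin m)) : ℝ :=
  √(metricMatrix G x₀ z).det

/-- The Laplace operator in the chart around `x₀`, applied to a function `F` of the coordinates:
`ΔF = (√G)⁻¹ ∂_A (√G G^{AB} ∂_B F)`. -/
def chartLaplacian (G : Metric m S) (x₀ : S) (F : EuclideanSpace ℝ (Fin m) → ℂ)
    (z : EuclideanSpace ℝ (Fin m)) : ℂ :=
  (volDensity G x₀ z)⁻¹ • ∑ A : Fin m,
    fderiv ℝ (fun w => ∑ B : Fin m,
      (volDensity G x₀ w * (metricMatrix G x₀ w)⁻¹ A B) •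
        fderiv ℝ F w (EuclideanSpace.single B (1 : ℝ))) z (EuclideanSpace.single A (1 : ℝ))

/-- `f` is a smooth function on `S` and `Δf = h`, where `Δ` is the Laplace-Beltrami operator of
`G`, expressed in local coordinates. -/
def HasLaplacian (G : Metric m S) (f h : S → ℂ) : Prop :=
  ContMDiff (𝓡 m) 𝓘(ℝ, ℂ) ∞ f ∧
    ∀ x₀ : S, ∀ z ∈ (extChartAt (𝓡 m) x₀).target,
      chartLaplacian G x₀ (f ∘ (extChartAt (𝓡 m) x₀).symm) z = h ((extChartAt (𝓡 m) x₀).symm z)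

variable [T2Space S] [CompactSpace S] [MeasurableSpace S]

/-- A smooth partition of unity on `S` subordinate to the domains of the charts. -/
def partitionOfUnity (m : ℕ) (S : Type*) [TopologicalSpace S]
    [ChartedSpace (EuclideanSpace ℝ (Fin m)) S] [IsManifold (𝓡 m) ∞ S] [T2Space S]
    [CompactSpace S] : SmoothPartitionOfUnity S (𝓡 m) S univ :=
  (SmoothPartitionOfUnity.exists_isSubordinate_chartAt_source (𝓡 m) S).choose

/-- The Riemannian volume measure: `∫ f = ∑ₓ ∫ (ρₓ f) √G dy`, the `x`-th integral being taken in the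
chart around `x`, with `(ρₓ)` a partition of unity subordinate to the charts. -/
def riemannianVolume (G : Metric m S) : Measure S :=
  Measure.sum fun x : S =>
    ((volume.restrict (extChartAt (𝓡 m) x).target).withDensity fun z =>
      ENNReal.ofReal
        (partitionOfUnity m S x ((extChartAt (𝓡 m) x).symm z) * volDensity G x z)).map
      (extChartAt (𝓡 m) x).symm

/-- `L²(S, ℂ)`. -/
abbrev L2Matter (G : Metric m S) := Lp ℂ 2 (riemannianVolume G)

/-- `a₀ = 2 n (n - 1) / α_M`. -/
def a0 (n : ℕ) (αM : ℝ) : ℝ := 2 * n * (n - 1) * αM⁻¹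

/-- `μ̄ = (4 / n²) a₀ μ - (m - 1)² / 4`. -/
def muBar (m n : ℕ) (αM μ : ℝ) : ℝ := 4 / (n : ℝ) ^ 2 * a0 n αM * μ - ((m : ℝ) - 1) ^ 2 / 4

/-- The space `𝓗₀ ⊆ L²(S, ℂ)` spanned by the eigenspaces of `-Δ` whose eigenvalues `μ`
satisfy `μ̄ ≤ 0`. -/
def H0 (G : Metric m S) (n : ℕ) (αM : ℝ) : Submodule ℂ (L2Matter G) :=
  Submodule.span ℂ {F | ∃ μ : ℝ, muBar m n αM μ ≤ 0 ∧
    ∃ f : S → ℂ, HasLaplacian G f (fun y => -((μ : ℂ) * f y)) ∧ F =ᵐ[riemannianVolume G] f}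

/-- `K = ΔF` for (the classes of) smooth functions in `L²(S, ℂ)`. -/
def IsLaplacianOf (G : Metric m S) (K F : L2Matter G) : Prop :=
  ∃ f h : S → ℂ, HasLaplacian G f h ∧
    F =ᵐ[riemannianVolume G] f ∧ K =ᵐ[riemannianVolume G] h

end Matter

/-! ### The radial variable -/

section Radial

/-- The measure `r^q dr` on `I`. -/
def radialMeasure (I : Set ℝ) (q : ℝ) : Measure ℝ :=
  (volume.restrict I).withDensity fun r => ENNReal.ofReal (r ^ q)

/-- `L²(I, q)`: the complex functions on `I` with `∫_I r^q |u|² < ∞`. -/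
abbrev L2Radial (I : Set ℝ) (q : ℝ) := Lp ℂ 2 (radialMeasure I q)

/-- `C_c^∞(I)` for an open set `I` of positive numbers, the functions being extended by zero
to all of `ℝ`. -/
def TestFn (I : Set ℝ) : Submodule ℂ (ℝ → ℂ) where
  carrier := {u | ContDiff ℝ ∞ u ∧ HasCompactSupport u ∧ tsupport u ⊆ I ∩ Ioi 0}
  add_mem' {u v} hu hv := ⟨hu.1.add hv.1, hu.2.1.add hv.2.1,
    (tsupport_add u v).trans (union_subset hu.2.2 hv.2.2)⟩
  zero_mem' := ⟨contDiff_const, HasCompactSupport.zero, by simp [tsupport]⟩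
  smul_mem' c u hu := ⟨contDiff_const.smul hu.1, hu.2.1.smul_left (f := fun _ => c),
    (tsupport_smul_subset_right (fun _ => c) u).trans hu.2.2⟩

theorem TestFn.differentiable {I : Set ℝ} (u : TestFn I) : Differentiable ℝ (u : ℝ → ℂ) :=
  u.2.1.differentiable (by simp)

/-- `u ↦ u̇` on `C_c^∞(I)`. -/
def TestFn.derivMap (I : Set ℝ) : TestFn I →ₗ[ℂ] TestFn I where
  toFun u := ⟨deriv (u : ℝ → ℂ), (contDiff_infty_iff_deriv.1 u.2.1).2, u.2.2.1.deriv,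
    (tsupport_deriv_subset (𝕜 := ℝ)).trans u.2.2.2⟩
  map_add' u v := by
    ext r
    exact deriv_add (TestFn.differentiable u r) (TestFn.differentiable v r)
  map_smul' c u := by
    ext r
    exact deriv_const_smul c (TestFn.differentiable u r)

theorem TestFn.contDiff_rpow_mul {I : Set ℝ} (u : TestFn I) (p : ℝ) :
    ContDiff ℝ ∞ fun r : ℝ => ((r ^ p : ℝ) : ℂ) * (u : ℝ → ℂ) r := by
  rw [contDiff_iff_contDiffAt]
  intro r
  by_cases hr : r ∈ tsupport (u : ℝ → ℂ)
  · have h0 : r ≠ 0 := ne_of_gt (u.2.2.2 hr).2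
    exact (Complex.ofRealCLM.contDiff.contDiffAt.comp r
      (Real.contDiffAt_rpow_const_of_ne h0)).mul u.2.1.contDiffAt
  · refine (contDiffAt_const (c := (0 : ℂ))).congr_of_eventuallyEq ?_
    filter_upwards [notMem_tsupport_iff_eventuallyEq.1 hr] with s hs
    simp [hs]

/-- `u ↦ r^p u` on `C_c^∞(I)`. -/
def TestFn.rpowMul (I : Set ℝ) (p : ℝ) : TestFn I →ₗ[ℂ] TestFn I where
  toFun u := ⟨fun r => ((r ^ p : ℝ) : ℂ) * (u : ℝ → ℂ) r, TestFn.contDiff_rpow_mul u p,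
    u.2.2.1.mul_left (f := fun r : ℝ => ((r ^ p : ℝ) : ℂ)),
    (tsupport_mul_subset_right (f := fun r : ℝ => ((r ^ p : ℝ) : ℂ))).trans u.2.2.2⟩
  map_add' u v := by
    ext r
    simp [mul_add]
  map_smul' c u := by
    ext r
    simp [mul_left_comm]

/-- `u ↦ r⁻¹ ∂_r (r ∂_r u)` on `C_c^∞(I)`. -/
def TestFn.radialKinetic (I : Set ℝ) : TestFn I →ₗ[ℂ] TestFn I :=
  TestFn.rpowMul I (-1) ∘ₗ TestFn.derivMap I ∘ₗ TestFn.rpowMul I 1 ∘ₗ TestFn.derivMap I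

theorem TestFn.memLp {I : Set ℝ} (u : TestFn I) : MemLp (u : ℝ → ℂ) 2 (radialMeasure I 1) := by
  have : IsLocallyFiniteMeasure (radialMeasure I 1) := by
    unfold radialMeasure
    simp only [Real.rpow_one]
    exact IsLocallyFiniteMeasure.withDensity_ofReal continuous_id
  exact u.2.1.continuous.memLp_of_hasCompactSupport u.2.2.1

/-- The embedding `C_c^∞(I) → L²(I, 1)`. -/
def TestFn.toL2 (I : Set ℝ) : TestFn I →ₗ[ℂ] L2Radial I 1 where
  toFun u := (TestFn.memLp u).toLp _
  map_add' u v := MemLp.toLp_add (TestFn.memLp u) (TestFn.memLp v)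
  map_smul' c u := MemLp.toLp_const_smul c (TestFn.memLp u)

end Radial

/-! ### Symmetric operators bounded above and their Friedrichs extensions -/

section Friedrichs

variable {E : Type*} [NormedAddCommGroup E] [InnerProductSpace ℂ E]

/-- `⟨Tφ, φ⟩ ≤ c ‖φ‖²` on the domain of `T`. -/
def BoundedAbove (T : E →ₗ.[ℂ] E) : Prop :=
  ∃ c : ℝ, ∀ φ : T.domain, (⟪T φ, (φ : E)⟫_ℂ).re ≤ c * ‖(φ : E)‖ ^ 2

/-- The quadratic form `⟨Tφ, φ⟩`. -/
def quadForm (T : E →ₗ.[ℂ] E) (φ : T.domain) : ℝ := (⟪T φ, (φ : E)⟫_ℂ).re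

/-- The sequence `φ k` in the domain of `T` converges to `ψ` and is a Cauchy sequence for the
energy form `⟨-Tφ, φ⟩`. -/
def FormConverges (T : E →ₗ.[ℂ] E) (φ : ℕ → T.domain) (ψ : E) : Prop :=
  Tendsto (fun k => (φ k : E)) atTop (𝓝 ψ) ∧
    Tendsto (fun p : ℕ × ℕ => quadForm T (φ p.1 - φ p.2)) atTop (𝓝 0)

theorem quadForm_parallelogram (T : E →ₗ.[ℂ] E) (a b : T.domain) :
    quadForm T (a + b) + quadForm T (a - b) = 2 * quadForm T a + 2 * quadForm T b := by
  simp only [quadForm, LinearPMap.map_add, LinearPMap.map_sub, Submodule.coe_add,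
    Submodule.coe_sub, inner_add_left, inner_add_right, inner_sub_left, inner_sub_right,
    Complex.add_re, Complex.sub_re]
  ring

theorem tendsto_sub_of_tendsto {E : Type*} [NormedAddCommGroup E] {φ : ℕ → E} {ψ : E} (h : Tendsto φ atTop (𝓝 ψ)) :
    Tendsto (fun p : ℕ × ℕ => φ p.1 - φ p.2) atTop (𝓝 0) := by
  rw [← prod_atTop_atTop_eq]
  simpa using (h.comp tendsto_fst).sub (h.comp tendsto_snd)

theorem FormConverges.add {T : E →ₗ.[ℂ] E} (hT : BoundedAbove T) {φ φ' : ℕ → T.domain}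
    {ψ ψ' : E} (h : FormConverges T φ ψ) (h' : FormConverges T φ' ψ') :
    FormConverges T (φ + φ') (ψ + ψ') := by
  obtain ⟨c, hc⟩ := hT
  refine ⟨by simpa using h.1.add h'.1, ?_⟩
  have e1 := tendsto_sub_of_tendsto h.1
  have e2 := tendsto_sub_of_tendsto h'.1
  have up : Tendsto (fun p : ℕ × ℕ => c * ‖((φ p.1 : E) - φ p.2) + ((φ' p.1 : E) - φ' p.2)‖ ^ 2)
      atTop (𝓝 0) := by
    simpa using ((e1.add e2).norm.pow 2).const_mul c
  have lo : Tendsto (fun p : ℕ × ℕ => 2 * quadForm T (φ p.1 - φ p.2)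
      + 2 * quadForm T (φ' p.1 - φ' p.2)
      - c * ‖((φ p.1 : E) - φ p.2) - ((φ' p.1 : E) - φ' p.2)‖ ^ 2) atTop (𝓝 0) := by
    simpa using ((h.2.const_mul 2).add (h'.2.const_mul 2)).sub
      (((e1.sub e2).norm.pow 2).const_mul c)
  refine tendsto_of_tendsto_of_tendsto_of_le_of_le lo up (fun p => ?_) (fun p => ?_)
  · have h1 := quadForm_parallelogram T (φ p.1 - φ p.2) (φ' p.1 - φ' p.2)
    have h2 := hc ((φ p.1 - φ p.2) - (φ' p.1 - φ' p.2))
    have h3 : (φ + φ') p.1 - (φ + φ') p.2 = (φ p.1 - φ p.2) + (φ' p.1 - φ' p.2) := by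
      simp only [Pi.add_apply]; abel
    simp only [h3]
    have h4 : quadForm T ((φ p.1 - φ p.2) - (φ' p.1 - φ' p.2)) ≤
        c * ‖((φ p.1 : E) - φ p.2) - ((φ' p.1 : E) - φ' p.2)‖ ^ 2 := h2
    linarith
  · have h2 := hc ((φ p.1 - φ p.2) + (φ' p.1 - φ' p.2))
    have h3 : (φ + φ') p.1 - (φ + φ') p.2 = (φ p.1 - φ p.2) + (φ' p.1 - φ' p.2) := by
      simp only [Pi.add_apply]; abel
    simp only [h3]
    simpa [quadForm] using h2

theorem FormConverges.smul {T : E →ₗ.[ℂ] E} (z : ℂ) {φ : ℕ → T.domain} {ψ : E}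
    (h : FormConverges T φ ψ) : FormConverges T (z • φ) (z • ψ) := by
  refine ⟨by simpa using h.1.const_smul z, ?_⟩
  have key : ∀ p : ℕ × ℕ, quadForm T ((z • φ) p.1 - (z • φ) p.2)
      = Complex.normSq z * quadForm T (φ p.1 - φ p.2) := by
    intro p
    have h3 : (z • φ) p.1 - (z • φ) p.2 = z • (φ p.1 - φ p.2) := by
      simp only [Pi.smul_apply, smul_sub]
    rw [h3, quadForm, quadForm, LinearPMap.map_smul, Submodule.coe_smul, inner_smul_left,
      inner_smul_right, ← mul_assoc, mul_comm ((starRingEnd ℂ) z) z, Complex.mul_conj,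
      Complex.re_ofReal_mul]
  simp only [key]
  simpa using h.2.const_mul (Complex.normSq z)

/-- The form domain (energy space) of an operator bounded above: the completion of its domain with
respect to the norm `⟨-Tφ, φ⟩ + (c + 1) ‖φ‖²`, realized as a subspace of `E`. -/
def formDomain (T : E →ₗ.[ℂ] E) (hT : BoundedAbove T) : Submodule ℂ E where
  carrier := {ψ | ∃ φ : ℕ → T.domain, FormConverges T φ ψ}
  add_mem' := fun ⟨_, h⟩ ⟨_, h'⟩ => ⟨_, h.add hT h'⟩
  zero_mem' := ⟨fun _ => 0, by simp [FormConverges, quadForm]⟩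
  smul_mem' := fun z _ ⟨_, h⟩ => ⟨_, h.smul z⟩

/-- The Friedrichs extension of a densely defined symmetric operator `T` that is bounded above:
its domain consists of the `ψ` in the form domain for which there is `χ ∈ E` with
`⟨ψ, Tφ⟩ = ⟨χ, φ⟩` for all `φ` in the domain of `T` ("`Tψ ∈ E` in the distributional sense"),
and it maps such a `ψ` to `χ`. -/
def friedrichs [CompleteSpace E] (T : E →ₗ.[ℂ] E) (hT : BoundedAbove T) : E →ₗ.[ℂ] E :=
  T.adjoint.domRestrict (formDomain T hT)

/-- The linear relation `Γ` is (the graph of) a densely defined symmetric operator that is bounded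
above, and the Friedrichs extension of this operator extends it and is selfadjoint. -/
def IsSelfAdjointInFriedrichsSense [CompleteSpace E] (Γ : Submodule ℂ (E × E)) : Prop :=
  ∃ T : E →ₗ.[ℂ] E, T.graph = Γ ∧ Dense (T.domain : Set E) ∧ T.IsFormalAdjoint T ∧
    ∃ hT : BoundedAbove T, T ≤ friedrichs T hT ∧ IsSelfAdjoint (friedrichs T hT)

end Friedrichs

/-! ### The Hamilton operator -/

section Hamiltonian

/-- `V̄ = α_M V / (n (n - 1))`. -/
def VBar (n : ℕ) (αM V : ℝ) : ℝ := αM / (n * (n - 1)) * V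

/-- `Λ̄ = 2 Λ / (n (n - 1))`. -/
def LambdaBar (n : ℕ) (Λ : ℝ) : ℝ := 2 / (n * (n - 1)) * Λ

variable {m : ℕ} {S : Type*} [TopologicalSpace S] [ChartedSpace (EuclideanSpace ℝ (Fin m)) S]
  [IsManifold (𝓡 m) ∞ S] [T2Space S] [CompactSpace S] [MeasurableSpace S]

/-- The Hilbert space tensor product `L²(I, 1) ⊗ 𝓗₀`. -/
abbrev StateSpace (G : Metric m S) (n : ℕ) (αM : ℝ) (I : Set ℝ) :=
  UniformSpace.Completion (L2Radial I 1 ⊗[ℂ] H0 G n αM)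

/-- The wave function `ψ(r, y) = u(r) F(y)`, with `u ∈ C_c^∞(I)` and `F ∈ 𝓗₀`, as an element of
`L²(I, 1) ⊗ 𝓗₀`. -/
def wave {G : Metric m S} {n : ℕ} {αM : ℝ} {I : Set ℝ} (u : TestFn I) (F : H0 G n αM) :
    StateSpace G n αM I :=
  ((TestFn.toL2 I u ⊗ₜ[ℂ] F : L2Radial I 1 ⊗[ℂ] H0 G n αM) : StateSpace G n αM I)

/-- The graph of the Hamilton operator
`Hψ = r⁻¹ ∂_r (r ∂_r ψ) + r⁻² (-(4/n²) a₀ Δψ - ((m-1)²/4) ψ) + (16/n²) (V̄ + Λ̄) r² ψ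
  - (16/n²) κ r^{2(n-2)/n} ψ`
on `C_c^∞(I) ⊗ 𝓗₀`: the pairs `(ψ, Hψ)` with `ψ = u F`, and their linear combinations. -/
def hamiltonianGraph (G : Metric m S) (n : ℕ) (αM V Λ κ : ℝ) (I : Set ℝ) :
    Submodule ℂ (StateSpace G n αM I × StateSpace G n αM I) :=
  Submodule.span ℂ {p | ∃ (u : TestFn I) (F K : H0 G n αM),
    IsLaplacianOf G (K : L2Matter G) (F : L2Matter G) ∧
    p.1 = wave u F ∧
    p.2 = wave (TestFn.radialKinetic I u) F
      + wave (TestFn.rpowMul I (-2) u)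
          (-((4 / (n : ℂ) ^ 2 * (a0 n αM : ℂ)) • K) - (((m : ℂ) - 1) ^ 2 / 4) • F)
      + (16 / (n : ℂ) ^ 2 * ((VBar n αM V + LambdaBar n Λ : ℝ) : ℂ)) •
          wave (TestFn.rpowMul I 2 u) F
      - (16 / (n : ℂ) ^ 2 * (κ : ℂ)) • wave (TestFn.rpowMul I (2 * ((n : ℝ) - 2) / n) u) F}

/-- The Hamilton operator is selfadjoint in `L²(I, 1) ⊗ 𝓗₀`, its domain of definition being that of
the Friedrichs extension. -/
def HamiltonianSelfAdjoint (G : Metric m S) (n : ℕ) (αM V Λ κ : ℝ) (I : Set ℝ) : Prop :=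
  IsSelfAdjointInFriedrichsSense (E := StateSpace G n αM I) (hamiltonianGraph G n αM V Λ κ I)

end Hamiltonian

end

end FriedmanQC

/-! For `F` with `-ΔF = μF` the operator acts on `u ⊗ F` as a radial operator with the constant `μ̄`
in front of `r⁻²`. Pairing with `v ⊗ F'` and integrating by parts gives `c⟨u, v⟩⟨F, F'⟩` minus three
Gram forms: `⟨u', v'⟩⟨F, F'⟩` from the kinetic term, `-μ̄⟨r⁻¹u, r⁻¹v⟩⟨F, F'⟩` from the singular
term, and `⟨√(c - W)u, √(c - W)v⟩⟨F, F'⟩` from the potential `W = A r² - B r^p`, `p = 2(n-2)/n`. The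
second is nonnegative because `μ̄ ≤ 0` on `𝓗₀` and different eigenspaces are orthogonal; the third
because `W ≤ c` on `I`. Hence `H` is symmetric and bounded above by `c`
(`isSelfAdjointInFriedrichsSense_separated`), and Friedrichs' theorem (`isSelfAdjoint_friedrichs`)
applies.

The only condition left is an upper bound for `W`. Since `0 ≤ p < 2`, it always holds on a bounded
interval; on `(0, ∞)` it holds if `A < 0`, where `r²` dominates, or if `A ≤ 0 ≤ B`.

Two points need care. The graph of `H` is given as a span, so that it is the graph of a map must be
deduced; it follows from symmetry and density. It is also generated by all pairs `(F, ΔF)` in `𝓗₀`,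
and `mem_span_eigenvectors` reduces these to eigenvectors. Both rest on the symmetry of the
Laplacian, `inner_laplacian`, obtained from Green's formula in charts with a partition of unity. -/

namespace FriedmanQC

/-! ### Friedrichs' theorem for symmetric operators bounded above. -/

section Friedrichs

variable {E : Type*} [NormedAddCommGroup E] [InnerProductSpace ℂ E] [CompleteSpace E]

/-- The completion of a vector space with respect to an inner product dominating the norm of `E`
along `j`, together with the extension of `j`. -/
theorem exists_completion_of_core.{u} {D : Type u} [AddCommGroup D] [Module ℂ D]
    (core : InnerProductSpace.Core ℂ D) (j : D →ₗ[ℂ] E)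
    (hj : ∀ x, ‖j x‖ ^ 2 ≤ (core.inner x x).re) :
    ∃ (H : Type u) (_ : NormedAddCommGroup H) (_ : InnerProductSpace ℂ H) (_ : CompleteSpace H)
      (e : D →ₗ[ℂ] H) (ι : H →L[ℂ] E), DenseRange e ∧ (∀ x, ι (e x) = j x) ∧
        ∀ x y, ⟪e x, e y⟫_ℂ = core.inner x y := by
  let _ : NormedAddCommGroup D := core.toNormedAddCommGroup
  let _ : InnerProductSpace ℂ D := InnerProductSpace.ofCore core.toCore
  have hbound : ∀ x, ‖j x‖ ≤ 1 * ‖x‖ := by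
    intro x
    rw [one_mul]
    have h1 : ‖x‖ ^ 2 = (core.inner x x).re := norm_sq_eq_re_inner (𝕜 := ℂ) x
    exact le_of_sq_le_sq (h1 ▸ hj x) (norm_nonneg _)
  let jc : D →L[ℂ] E := j.mkContinuous 1 hbound
  let e : D →L[ℂ] UniformSpace.Completion D := UniformSpace.Completion.toComplL
  have hd : DenseRange e := UniformSpace.Completion.denseRange_coe
  have hu : IsUniformInducing e := UniformSpace.Completion.isUniformInducing_coe D
  refine ⟨UniformSpace.Completion D, inferInstance, inferInstance, inferInstance,
    (e : D →ₗ[ℂ] UniformSpace.Completion D), jc.extend e, hd, fun x => ?_, fun x y => ?_⟩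
  · exact ContinuousLinearMap.extend_eq jc hd hu x
  · exact UniformSpace.Completion.inner_coe x y

/-- The energy space of a symmetric operator bounded above. -/
theorem exists_energySpace.{u} {E : Type u} [NormedAddCommGroup E] [InnerProductSpace ℂ E]
    [CompleteSpace E] (T : E →ₗ.[ℂ] E) (hsym : T.IsFormalAdjoint T) {c : ℝ}
    (hc : ∀ φ : T.domain, (⟪T φ, (φ : E)⟫_ℂ).re ≤ c * ‖(φ : E)‖ ^ 2) :
    ∃ (H : Type u) (_ : NormedAddCommGroup H) (_ : InnerProductSpace ℂ H) (_ : CompleteSpace H)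
      (e : T.domain →ₗ[ℂ] H) (ι : H →L[ℂ] E), DenseRange e ∧ (∀ x, ι (e x) = x) ∧
        ∀ x y, ⟪e x, e y⟫_ℂ = ⟪((c + 1 : ℝ) : ℂ) • (x : E) - T x, (y : E)⟫_ℂ := by
  -- The shift `c + 1` rather than `c` makes the energy inner product dominate that of `E`; this
  -- gives definiteness and the continuity of `ι`.
  have hge : ∀ x : T.domain,
      ‖(x : E)‖ ^ 2 ≤ (⟪((c + 1 : ℝ) : ℂ) • (x : E) - T x, (x : E)⟫_ℂ).re := by
    intro x
    have h := hc x
    rw [inner_sub_left, inner_smul_left, Complex.conj_ofReal, Complex.sub_re,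
      Complex.re_ofReal_mul]
    have h2 : (⟪(x : E), (x : E)⟫_ℂ).re = ‖(x : E)‖ ^ 2 := (norm_sq_eq_re_inner (𝕜 := ℂ) _).symm
    rw [h2]
    linarith
  let core : InnerProductSpace.Core ℂ T.domain :=
    { inner := fun x y => ⟪((c + 1 : ℝ) : ℂ) • (x : E) - T x, (y : E)⟫_ℂ
      conj_inner_symm := fun x y => by
        simp only [inner_sub_left, inner_smul_left, map_sub, map_mul, Complex.conj_ofReal,
          inner_conj_symm]
        rw [hsym x y]
      re_inner_nonneg := fun x => (sq_nonneg _).trans (hge x)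
      add_left := fun x y z => by
        simp only [Submodule.coe_add, LinearPMap.map_add, ← inner_add_left]
        congr 1
        rw [smul_add]; abel
      smul_left := fun x y r => by
        simp only [Submodule.coe_smul, LinearPMap.map_smul, ← inner_smul_left]
        congr 1
        rw [smul_sub, smul_comm]
      definite := fun x hx => by
        have h := hge x
        have h0 : (⟪((c + 1 : ℝ) : ℂ) • (x : E) - T x, (x : E)⟫_ℂ) = 0 := hx
        rw [h0] at h
        have : ‖(x : E)‖ = 0 := by
          have := sq_nonneg ‖(x : E)‖
          exact pow_eq_zero_iff (two_ne_zero) |>.1 (le_antisymm h this)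
        exact Subtype.ext (norm_eq_zero.1 this) }
  exact exists_completion_of_core core T.domain.subtype hge

theorem friedrichs_apply {T : E →ₗ.[ℂ] E} {hT : BoundedAbove T} (ψ : (friedrichs T hT).domain) :
    friedrichs T hT ψ = T.adjoint ⟨ψ, ψ.2.2⟩ :=
  LinearPMap.domRestrict_apply rfl

/-- Constant sequences put the domain of `T` into the form domain, and a symmetric densely defined
`T` is contained in its adjoint. -/
theorem le_friedrichs {T : E →ₗ.[ℂ] E} (hd : Dense (T.domain : Set E))
    (hsym : T.IsFormalAdjoint T) (hT : BoundedAbove T) : T ≤ friedrichs T hT := by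
  have hle : T ≤ T.adjoint := LinearPMap.IsFormalAdjoint.le_adjoint hd hsym
  refine ⟨fun x hx => ⟨⟨fun _ => ⟨x, hx⟩, ?_⟩, hle.1 hx⟩, fun x y hxy => ?_⟩
  · simp [FormConverges, quadForm]
  · rw [friedrichs_apply]
    exact hle.2 hxy

/-- A symmetric operator `A` such that `A - a` is onto for a real number `a` is selfadjoint. -/
theorem isSelfAdjoint_of_surjective {A : E →ₗ.[ℂ] E} (hd : Dense (A.domain : Set E))
    (hsym : A.IsFormalAdjoint A) (a : ℝ)
    (hsurj : ∀ x : E, ∃ ψ : A.domain, (a : ℂ) • (ψ : E) - A ψ = x) : IsSelfAdjoint A := by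
  rw [LinearPMap.isSelfAdjoint_def]
  have hle : A ≤ A.adjoint := LinearPMap.IsFormalAdjoint.le_adjoint hd hsym
  have hfa : A.adjoint.IsFormalAdjoint A := LinearPMap.adjoint_isFormalAdjoint hd
  refine (LinearPMap.eq_of_le_of_domain_eq hle (le_antisymm hle.1 fun ψ hψ => ?_)).symm
  -- `ψ₀` solves `(a - A)ψ₀ = (a - A†)ψ`. With `ψ - ψ₀ = (a - A)φ`, moving `a - A` across the inner
  -- product gives `‖ψ - ψ₀‖² = 0`, so `ψ` lies in the domain of `A`.
  obtain ⟨ψ₀, h₀⟩ := hsurj ((a : ℂ) • ψ - A.adjoint ⟨ψ, hψ⟩)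
  obtain ⟨φ, hφ⟩ := hsurj (ψ - ψ₀)
  have h1 : ⟪A.adjoint ⟨ψ, hψ⟩, (φ : E)⟫_ℂ = ⟪ψ, A φ⟫_ℂ := hfa _ _
  have h2 : ⟪A ψ₀, (φ : E)⟫_ℂ = ⟪(ψ₀ : E), A φ⟫_ℂ := hsym _ _
  have h3 : ⟪ψ - ψ₀, (a : ℂ) • (φ : E) - A φ⟫_ℂ = 0 := by
    have h4 : ⟪(a : ℂ) • (ψ₀ : E) - A ψ₀, (φ : E)⟫_ℂ
        = ⟪(a : ℂ) • ψ - A.adjoint ⟨ψ, hψ⟩, (φ : E)⟫_ℂ := by rw [h₀]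
    simp only [inner_sub_left, inner_smul_left, Complex.conj_ofReal, h1, h2] at h4
    simp only [inner_sub_left, inner_sub_right, inner_smul_right]
    linear_combination -h4
  rw [hφ, inner_self_eq_zero, sub_eq_zero] at h3
  rw [h3]
  exact ψ₀.2

/-- Friedrichs' theorem. -/
theorem isSelfAdjoint_friedrichs {T : E →ₗ.[ℂ] E} (hd : Dense (T.domain : Set E))
    (hsym : T.IsFormalAdjoint T) (hT : BoundedAbove T) : IsSelfAdjoint (friedrichs T hT) := by
  obtain ⟨c, hc⟩ := id hT
  obtain ⟨H, _, _, _, e, ι, he, hι, hin⟩ := exists_energySpace T hsym hc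
  -- True for `h = e x` by symmetry, hence for all `h` by density. It determines `h` from `ι h`,
  -- which stands in for closability of the form.
  have hweak : ∀ (h : H) (φ : T.domain),
      ⟪h, e φ⟫_ℂ = ⟪ι h, ((c + 1 : ℝ) : ℂ) • (φ : E) - T φ⟫_ℂ := by
    intro h φ
    refine he.induction_on (p := fun h => ⟪h, e φ⟫_ℂ = ⟪ι h, ((c + 1 : ℝ) : ℂ) • (φ : E) - T φ⟫_ℂ)
      h (isClosed_eq (by fun_prop) (by fun_prop)) fun x => ?_
    rw [hin, hι, inner_sub_left, inner_sub_right, inner_smul_left, inner_smul_right, hsym x φ,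
      Complex.conj_ofReal]
  have hq : ∀ x : T.domain, ‖e x‖ ^ 2 = (c + 1) * ‖(x : E)‖ ^ 2 - quadForm T x := by
    intro x
    have h1 : ‖e x‖ ^ 2 = (⟪e x, e x⟫_ℂ).re := norm_sq_eq_re_inner (𝕜 := ℂ) (e x)
    have h2 : (⟪(x : E), (x : E)⟫_ℂ).re = ‖(x : E)‖ ^ 2 := (norm_sq_eq_re_inner (𝕜 := ℂ) _).symm
    rw [h1, hin, inner_sub_left, inner_smul_left, Complex.conj_ofReal, Complex.sub_re,
      Complex.re_ofReal_mul, h2, quadForm]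
  -- By `hq`, a sequence converging in `E` is Cauchy for the energy form exactly when its image
  -- under `e` is Cauchy in `H`.
  have hform : ∀ ψ : E, ψ ∈ formDomain T hT ↔ ∃ h : H, ι h = ψ := by
    intro ψ
    constructor
    · rintro ⟨φ, h1, h2⟩
      have h3 := tendsto_sub_of_tendsto h1
      have h4 : Tendsto (fun p : ℕ × ℕ => ‖e (φ p.1) - e (φ p.2)‖ ^ 2) atTop (𝓝 0) := by
        have := ((h3.norm.pow 2).const_mul (c + 1)).sub h2
        simp only [norm_zero, ne_eq, OfNat.ofNat_ne_zero, not_false_eq_true, zero_pow, mul_zero,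
          sub_zero] at this
        refine this.congr fun p => ?_
        rw [← map_sub, hq]
        simp
      have h5 : CauchySeq fun k => e (φ k) := by
        rw [cauchySeq_iff_tendsto_dist_atTop_0]
        have := h4.sqrt
        simpa [dist_eq_norm, Real.sqrt_sq (norm_nonneg _)] using this
      obtain ⟨h, hh⟩ := cauchySeq_tendsto_of_complete h5
      refine ⟨h, tendsto_nhds_unique ((ι.continuous.tendsto h).comp hh) ?_⟩
      simpa [Function.comp_def, hι] using h1
    · rintro ⟨h, rfl⟩
      obtain ⟨y, hy, hlim⟩ := mem_closure_iff_seq_limit.1 (he h)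
      choose φ hφ using hy
      have hφ' : Tendsto (fun k => e (φ k)) atTop (𝓝 h) := by simpa [hφ] using hlim
      have h1 : Tendsto (fun k => (φ k : E)) atTop (𝓝 (ι h)) := by
        simpa [Function.comp_def, hι] using (ι.continuous.tendsto h).comp hφ'
      refine ⟨φ, h1, ?_⟩
      have h3 := tendsto_sub_of_tendsto h1
      have h4 := tendsto_sub_of_tendsto hφ'
      have := ((h3.norm.pow 2).const_mul (c + 1)).sub (h4.norm.pow 2)
      simp only [norm_zero, ne_eq, OfNat.ofNat_ne_zero, not_false_eq_true, zero_pow, mul_zero,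
        sub_zero] at this
      refine this.congr fun p => ?_
      rw [← map_sub, hq]
      simp
  have hfa : T.adjoint.IsFormalAdjoint T := LinearPMap.adjoint_isFormalAdjoint hd
  have hval : ∀ (ψ : (friedrichs T hT).domain) (φ : T.domain),
      ⟪friedrichs T hT ψ, (φ : E)⟫_ℂ = ⟪(ψ : E), T φ⟫_ℂ := by
    intro ψ φ
    rw [friedrichs_apply]
    exact hfa _ φ
  have hext : ∀ x y : E, (∀ φ : T.domain, ⟪x, (φ : E)⟫_ℂ = ⟪y, (φ : E)⟫_ℂ) → x = y :=
    fun x y h => hd.eq_of_inner_left ℂ fun v hv => h ⟨v, hv⟩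
  -- `R` is the resolvent at `c + 1`: by `hweak`, `⟨R x, (c + 1)φ - Tφ⟩ = ⟨ι† x, e φ⟩ = ⟨x, φ⟩`,
  -- which is the weak equation for `R x`. The symmetry of the extension is then read off from that
  -- of `ι ι†`.
  set R : E →L[ℂ] E := ι ∘L ι.adjoint with hR
  have hRdom : ∀ x, ∃ ψ : (friedrichs T hT).domain, (ψ : E) = R x ∧
      ((c + 1 : ℝ) : ℂ) • (ψ : E) - friedrichs T hT ψ = x := by
    intro x
    have hw : ∀ φ : T.domain, ⟪((c + 1 : ℝ) : ℂ) • R x - x, (φ : E)⟫_ℂ = ⟪R x, T φ⟫_ℂ := by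
      intro φ
      have h1 := hweak (ι.adjoint x) φ
      rw [ContinuousLinearMap.adjoint_inner_left, hι, inner_sub_right, inner_smul_right] at h1
      rw [inner_sub_left, inner_smul_left, Complex.conj_ofReal, h1]
      simp [hR]
    have hm : R x ∈ (friedrichs T hT).domain :=
      ⟨(hform _).2 ⟨ι.adjoint x, rfl⟩, LinearPMap.mem_adjoint_domain_of_exists _ ⟨_, hw⟩⟩
    refine ⟨⟨R x, hm⟩, rfl, ?_⟩
    have : friedrichs T hT ⟨R x, hm⟩ = ((c + 1 : ℝ) : ℂ) • R x - x :=
      hext _ _ fun φ => by rw [hval, hw]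
    rw [this]
    simp
  have hinj : ∀ ψ : (friedrichs T hT).domain,
      ((c + 1 : ℝ) : ℂ) • (ψ : E) - friedrichs T hT ψ = 0 → (ψ : E) = 0 := by
    intro ψ h0
    obtain ⟨h, hh⟩ := (hform ψ).1 ψ.2.1
    have h1 : h = 0 := by
      refine he.eq_zero_of_inner_left ℂ ?_
      intro φ
      have h2 := hval ψ φ
      rw [sub_eq_zero] at h0
      change ⟪h, e φ⟫_ℂ = 0
      rw [hweak, hh, inner_sub_right, inner_smul_right, ← h2, ← h0, inner_smul_left,
        Complex.conj_ofReal, sub_self]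
    rw [← hh, h1, map_zero]
  have hres : ∀ ψ : (friedrichs T hT).domain,
      R (((c + 1 : ℝ) : ℂ) • (ψ : E) - friedrichs T hT ψ) = ψ := by
    intro ψ
    obtain ⟨ψ', h1, h2⟩ := hRdom (((c + 1 : ℝ) : ℂ) • (ψ : E) - friedrichs T hT ψ)
    rw [← h1]
    have := hinj (ψ' - ψ) (by
      rw [LinearPMap.map_sub, Submodule.coe_sub, smul_sub]
      rw [← sub_eq_zero] at h2
      rw [← h2]; abel)
    rw [Submodule.coe_sub, sub_eq_zero] at this
    exact this
  have hRsym : ∀ x y, ⟪R x, y⟫_ℂ = ⟪x, R y⟫_ℂ := by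
    intro x y
    simp only [hR, ContinuousLinearMap.comp_apply]
    rw [← ContinuousLinearMap.adjoint_inner_right, ContinuousLinearMap.adjoint_inner_left]
  refine isSelfAdjoint_of_surjective (hd.mono (le_friedrichs hd hsym hT).1) ?_ (c + 1)
    fun x => (hRdom x).imp fun _ h => h.2
  intro ψ ψ'
  have h1 := hRsym (((c + 1 : ℝ) : ℂ) • (ψ : E) - friedrichs T hT ψ)
    (((c + 1 : ℝ) : ℂ) • (ψ' : E) - friedrichs T hT ψ')
  rw [hres, hres, inner_sub_left, inner_sub_right, inner_smul_left, inner_smul_right,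
    Complex.conj_ofReal] at h1
  linear_combination h1

/-- A symmetric relation with dense first projection is single-valued: if `p.1 = 0`, then `p.2` is
orthogonal to every first component. It is therefore the graph of an operator to which Friedrichs'
theorem applies. -/
theorem isSelfAdjointInFriedrichsSense {Γ : Submodule ℂ (E × E)}
    (hd : Dense (Prod.fst '' (Γ : Set (E × E))))
    (hsym : ∀ p ∈ Γ, ∀ q ∈ Γ, ⟪p.2, q.1⟫_ℂ = ⟪p.1, q.2⟫_ℂ)
    (hb : ∃ c : ℝ, ∀ p ∈ Γ, (⟪p.2, p.1⟫_ℂ).re ≤ c * ‖p.1‖ ^ 2) :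
    IsSelfAdjointInFriedrichsSense Γ := by
  have hsingle : ∀ p ∈ Γ, p.1 = 0 → p.2 = 0 := by
    intro p hp h0
    refine hd.eq_zero_of_inner_left ℂ ?_
    rintro _ ⟨q, hq, rfl⟩
    change ⟪p.2, q.1⟫_ℂ = 0
    rw [hsym p hp q hq, h0, inner_zero_left]
  have hgr : ∀ x : Γ.toLinearPMap.domain, ((x : E), Γ.toLinearPMap x) ∈ Γ :=
    Submodule.mem_graph_toLinearPMap hsingle
  have hd' : Dense (Γ.toLinearPMap.domain : Set E) := by
    rw [Submodule.toLinearPMap_domain]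
    simpa using hd
  have hs : Γ.toLinearPMap.IsFormalAdjoint Γ.toLinearPMap := fun x y => hsym _ (hgr x) _ (hgr y)
  have hB : BoundedAbove Γ.toLinearPMap := hb.imp fun c h φ => h _ (hgr φ)
  exact ⟨Γ.toLinearPMap, Submodule.toLinearPMap_graph_eq Γ hsingle, hd', hs, hB,
    le_friedrichs hd' hs hB, isSelfAdjoint_friedrichs hd' hs hB⟩

end Friedrichs

/-! ### The radial Hilbert space, test functions and the potential. -/

section Radial

variable {I : Set ℝ}

theorem isLocallyFiniteMeasure_radialMeasure (I : Set ℝ) :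
    IsLocallyFiniteMeasure (radialMeasure I 1) := by
  unfold radialMeasure
  simp only [Real.rpow_one]
  exact IsLocallyFiniteMeasure.withDensity_ofReal continuous_id

theorem ae_radialMeasure_of_forall (hI : IsOpen I) {p : ℝ → Prop} (hp : ∀ r ∈ I, p r) (q : ℝ) :
    ∀ᵐ r ∂radialMeasure I q, p r := by
  refine (withDensity_absolutelyContinuous _ _).ae_le ?_
  filter_upwards [ae_restrict_mem hI.measurableSet] with r hr using hp r hr

theorem inner_toLp_congr (hI : IsOpen I) {f g f' g' : ℝ → ℂ} (hf : MemLp f 2 (radialMeasure I 1))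
    (hg : MemLp g 2 (radialMeasure I 1)) (hf' : MemLp f' 2 (radialMeasure I 1))
    (hg' : MemLp g' 2 (radialMeasure I 1)) (h : ∀ r ∈ I, ⟪f r, g r⟫_ℂ = ⟪f' r, g' r⟫_ℂ) :
    ⟪hf.toLp f, hg.toLp g⟫_ℂ = ⟪hf'.toLp f', hg'.toLp g'⟫_ℂ := by
  rw [L2.inner_def, L2.inner_def]
  refine integral_congr_ae ?_
  filter_upwards [hf.coeFn_toLp, hg.coeFn_toLp, hf'.coeFn_toLp, hg'.coeFn_toLp,
    ae_radialMeasure_of_forall hI h 1] with r h1 h2 h3 h4 h5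
  rw [h1, h2, h3, h4, h5]

theorem TestFn.eq_zero_of_notMem (u : TestFn I) {r : ℝ} (hr : r ∉ I ∩ Ioi 0) :
    (u : ℝ → ℂ) r = 0 :=
  image_eq_zero_of_notMem_tsupport fun h => hr (u.2.2.2 h)

theorem integral_radialMeasure_one {F : ℝ → ℂ} (hF : ∀ r, r ∉ I ∩ Ioi 0 → F r = 0) :
    ∫ r, F r ∂radialMeasure I 1 = ∫ r : ℝ, (r : ℂ) * F r := by
  rw [radialMeasure, integral_withDensity_eq_integral_toReal_smul (by fun_prop) (by simp)]
  have h1 : ∀ r : ℝ, (ENNReal.ofReal (r ^ (1 : ℝ))).toReal • F r = (r : ℂ) * F r := by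
    intro r
    by_cases h : 0 < r
    · rw [Real.rpow_one, ENNReal.toReal_ofReal h.le, Complex.real_smul]
    · rw [hF r fun h' => h h'.2, smul_zero, mul_zero]
  simp only [h1]
  exact setIntegral_eq_integral_of_forall_compl_eq_zero
    fun r hr => by rw [hF r fun h => hr h.1, mul_zero]

/-- Since test functions vanish off `I ∩ Ioi 0`, the integral may be taken over the whole line,
where integration by parts has no boundary terms. -/
theorem inner_toL2 (u v : TestFn I) :
    ⟪TestFn.toL2 I u, TestFn.toL2 I v⟫_ℂ
      = ∫ r : ℝ, (r : ℂ) * (starRingEnd ℂ ((u : ℝ → ℂ) r) * (v : ℝ → ℂ) r) := by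
  rw [L2.inner_def, ← integral_radialMeasure_one (I := I)
    fun r hr => by rw [TestFn.eq_zero_of_notMem v hr, mul_zero]]
  refine integral_congr_ae ?_
  filter_upwards [(TestFn.memLp u).coeFn_toLp, (TestFn.memLp v).coeFn_toLp] with r h1 h2
  change ⟪((TestFn.memLp u).toLp _) r, ((TestFn.memLp v).toLp _) r⟫_ℂ = _
  rw [h1, h2, RCLike.inner_apply, mul_comm]

theorem integral_conj_deriv_mul (w v : TestFn I) :
    ∫ r, starRingEnd ℂ (deriv (w : ℝ → ℂ) r) * (v : ℝ → ℂ) r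
      = -∫ r, starRingEnd ℂ ((w : ℝ → ℂ) r) * deriv (v : ℝ → ℂ) r := by
  have hw : ∀ r, HasDerivAt (fun r => starRingEnd ℂ ((w : ℝ → ℂ) r))
      (starRingEnd ℂ (deriv (w : ℝ → ℂ) r)) r := fun r => (TestFn.differentiable w r).hasDerivAt.star
  have hv : ∀ r, HasDerivAt (v : ℝ → ℂ) (deriv (v : ℝ → ℂ) r) r :=
    fun r => (TestFn.differentiable v r).hasDerivAt
  have hi : ∀ a b : TestFn I,
      Integrable ((fun r => starRingEnd ℂ ((a : ℝ → ℂ) r)) * (b : ℝ → ℂ)) := fun a b =>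
    ((Complex.continuous_conj.comp a.2.1.continuous).mul
      b.2.1.continuous).integrable_of_hasCompactSupport b.2.2.1.mul_left
  have := integral_mul_deriv_eq_deriv_mul_of_integrable (fun r _ => hw r) (fun r _ => hv r)
    (hi w (TestFn.derivMap I v))
    (hi (TestFn.derivMap I w) v) (hi w v)
  exact (neg_eq_iff_eq_neg.2 this).symm

/-- The weight `r` of the measure cancels the factor `r⁻¹`, leaving `∫ (r ū')' v = -∫ r ū' v'`. -/
theorem inner_radialKinetic (u v : TestFn I) :
    ⟪TestFn.toL2 I (TestFn.radialKinetic I u), TestFn.toL2 I v⟫_ℂ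
      = -⟪TestFn.toL2 I (TestFn.derivMap I u), TestFn.toL2 I (TestFn.derivMap I v)⟫_ℂ := by
  rw [inner_toL2, inner_toL2]
  have h := integral_conj_deriv_mul (TestFn.rpowMul I 1 (TestFn.derivMap I u)) v
  have h1 : ∀ r : ℝ, (r : ℂ) * (starRingEnd ℂ ((TestFn.radialKinetic I u : ℝ → ℂ) r)
      * (v : ℝ → ℂ) r) = starRingEnd ℂ
        (deriv (TestFn.rpowMul I 1 (TestFn.derivMap I u) : ℝ → ℂ) r)
        * (v : ℝ → ℂ) r := by
    intro r
    by_cases hr : 0 < r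
    · change (r : ℂ) * (starRingEnd ℂ (((r ^ (-1 : ℝ) : ℝ) : ℂ)
        * deriv (TestFn.rpowMul I 1 (TestFn.derivMap I u) : ℝ → ℂ) r)
          * (v : ℝ → ℂ) r) = _
      rw [Real.rpow_neg_one, map_mul, Complex.conj_ofReal, Complex.ofReal_inv]
      have : (r : ℂ) ≠ 0 := by exact_mod_cast hr.ne'
      field_simp
    · rw [TestFn.eq_zero_of_notMem v fun h' => hr h'.2]
      simp
  have h2 : ∀ r : ℝ, (r : ℂ) * (starRingEnd ℂ ((TestFn.derivMap I u : ℝ → ℂ) r)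
      * (TestFn.derivMap I v : ℝ → ℂ) r) = starRingEnd ℂ
        ((TestFn.rpowMul I 1 (TestFn.derivMap I u) : ℝ → ℂ) r) * deriv (v : ℝ → ℂ) r := by
    intro r
    change (r : ℂ) * (starRingEnd ℂ (deriv (u : ℝ → ℂ) r) * deriv (v : ℝ → ℂ) r)
      = starRingEnd ℂ (((r ^ (1 : ℝ) : ℝ) : ℂ) * deriv (u : ℝ → ℂ) r) * deriv (v : ℝ → ℂ) r
    rw [Real.rpow_one, map_mul, Complex.conj_ofReal, mul_assoc]
  simp only [h1, h2]
  exact h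

theorem inner_rpowMul_neg_two (hI : IsOpen I) (hpos : I ⊆ Ioi 0) (u v : TestFn I) :
    ⟪TestFn.toL2 I (TestFn.rpowMul I (-2) u), TestFn.toL2 I v⟫_ℂ
      = ⟪TestFn.toL2 I (TestFn.rpowMul I (-1) u), TestFn.toL2 I (TestFn.rpowMul I (-1) v)⟫_ℂ := by
  refine inner_toLp_congr hI (TestFn.memLp _) (TestFn.memLp _) (TestFn.memLp _)
    (TestFn.memLp _) fun r hr => ?_
  change ⟪((r ^ (-2 : ℝ) : ℝ) : ℂ) * (u : ℝ → ℂ) r, (v : ℝ → ℂ) r⟫_ℂ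
    = ⟪((r ^ (-1 : ℝ) : ℝ) : ℂ) * (u : ℝ → ℂ) r, ((r ^ (-1 : ℝ) : ℝ) : ℂ) * (v : ℝ → ℂ) r⟫_ℂ
  have h : r ^ (-2 : ℝ) = r ^ (-1 : ℝ) * r ^ (-1 : ℝ) := by
    rw [← Real.rpow_add (hpos hr)]; norm_num
  simp only [RCLike.inner_apply, map_mul, Complex.conj_ofReal, h, Complex.ofReal_mul]
  ring

theorem memLp_sqrt_mul {w : ℝ → ℝ} (hw : Continuous w) (u : TestFn I) :
    MemLp (fun r => (√(w r) : ℂ) * (u : ℝ → ℂ) r) 2 (radialMeasure I 1) := by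
  have := isLocallyFiniteMeasure_radialMeasure I
  exact ((Complex.continuous_ofReal.comp hw.sqrt).mul
    u.2.1.continuous).memLp_of_hasCompactSupport u.2.2.1.mul_left

/-- With `W = A r² - B r^p`, take `f u = √(c - W) u`; the root squares to `c - W` because `W ≤ c` on
`I`. The condition `0 ≤ p` makes the weight continuous on all of `ℝ`, so that `f u` is square
integrable. -/
theorem inner_potential (hI : IsOpen I) {A B c p : ℝ} (hp : 0 ≤ p)
    (hc : ∀ r ∈ I, A * r ^ (2 : ℝ) - B * r ^ p ≤ c) :
    ∃ f : TestFn I → L2Radial I 1, ∀ u v : TestFn I,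
      (A : ℂ) * ⟪TestFn.toL2 I (TestFn.rpowMul I 2 u), TestFn.toL2 I v⟫_ℂ
        - (B : ℂ) * ⟪TestFn.toL2 I (TestFn.rpowMul I p u), TestFn.toL2 I v⟫_ℂ
      = (c : ℂ) * ⟪TestFn.toL2 I u, TestFn.toL2 I v⟫_ℂ - ⟪f u, f v⟫_ℂ := by
  have hw : Continuous fun r : ℝ => c - (A * r ^ (2 : ℝ) - B * r ^ p) :=
    continuous_const.sub ((continuous_const.mul (Real.continuous_rpow_const (by norm_num))).sub
      (continuous_const.mul (Real.continuous_rpow_const hp)))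
  refine ⟨fun u => (memLp_sqrt_mul hw u).toLp _, fun u v => ?_⟩
  have h : ⟪TestFn.toL2 I ((c : ℂ) • u - (A : ℂ) • TestFn.rpowMul I 2 u
      + (B : ℂ) • TestFn.rpowMul I p u), TestFn.toL2 I v⟫_ℂ
      = ⟪(memLp_sqrt_mul hw u).toLp _, (memLp_sqrt_mul hw v).toLp _⟫_ℂ := by
    refine inner_toLp_congr hI (TestFn.memLp _) (TestFn.memLp _) _ _ fun r hr => ?_
    change ⟪(c : ℂ) * (u : ℝ → ℂ) r - (A : ℂ) * (((r ^ (2 : ℝ) : ℝ) : ℂ) * (u : ℝ → ℂ) r)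
      + (B : ℂ) * (((r ^ p : ℝ) : ℂ) * (u : ℝ → ℂ) r), (v : ℝ → ℂ) r⟫_ℂ = _
    have hs : (√(c - (A * r ^ (2 : ℝ) - B * r ^ p)) : ℂ) * √(c - (A * r ^ (2 : ℝ) - B * r ^ p))
        = (c : ℂ) - ((A : ℂ) * ((r ^ (2 : ℝ) : ℝ) : ℂ) - (B : ℂ) * ((r ^ p : ℝ) : ℂ)) := by
      rw [← Complex.ofReal_mul, Real.mul_self_sqrt (by linarith [hc r hr])]
      push_cast
      ring
    simp only [RCLike.inner_apply, map_mul, map_add, map_sub, Complex.conj_ofReal]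
    linear_combination -((v : ℝ → ℂ) r * starRingEnd ℂ ((u : ℝ → ℂ) r)) * hs
  rw [← h]
  simp only [map_add, map_sub, map_smul, inner_add_left, inner_sub_left, inner_smul_left,
    Complex.conj_ofReal]
  ring

/-- A vector orthogonal to all test functions, real ones being enough, vanishes almost everywhere by
the fundamental lemma of the calculus of variations. -/
theorem denseRange_toL2 (hI : IsOpen I) (hpos : I ⊆ Ioi 0) : DenseRange (TestFn.toL2 I) := by
  have := isLocallyFiniteMeasure_radialMeasure I
  change Dense (LinearMap.range (TestFn.toL2 I) : Set (L2Radial I 1))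
  rw [Submodule.dense_iff_topologicalClosure_eq_top,
    Submodule.topologicalClosure_eq_top_iff, Submodule.eq_bot_iff]
  intro w hw
  rw [Submodule.mem_orthogonal] at hw
  have hli : LocallyIntegrableOn (w : ℝ → ℂ) I (radialMeasure I 1) :=
    ((Lp.memLp w).locallyIntegrable (by norm_num)).locallyIntegrableOn I
  have h := hI.ae_eq_zero_of_integral_contDiff_smul_eq_zero hli fun g hg hgc hgs => by
    let u : TestFn I := ⟨fun r => (g r : ℂ), Complex.ofRealCLM.contDiff.comp hg,
      hgc.comp_left Complex.ofReal_zero,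
      (tsupport_comp_subset Complex.ofReal_zero g).trans fun r hr => ⟨hgs hr, hpos (hgs hr)⟩⟩
    have h0 := hw _ ⟨u, rfl⟩
    rw [L2.inner_def] at h0
    rw [← h0]
    refine integral_congr_ae ?_
    filter_upwards [(TestFn.memLp u).coeFn_toLp] with r h1
    change _ = ⟪((TestFn.memLp u).toLp _) r, _⟫_ℂ
    rw [h1, RCLike.inner_apply, Complex.conj_ofReal, Complex.real_smul, mul_comm]
  refine (Lp.eq_zero_iff_ae_eq_zero).2 ?_
  filter_upwards [h, ae_radialMeasure_of_forall hI (fun r hr => hr) 1] with r h1 h2 using h1 h2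

/-- The potential is bounded above on bounded intervals. -/
theorem exists_potential_le_of_bounded (A B p r₀ : ℝ) (hp : 0 ≤ p) :
    ∃ c : ℝ, ∀ r ∈ Ioo 0 r₀, A * r ^ (2 : ℝ) - B * r ^ p ≤ c := by
  refine ⟨|A| * r₀ ^ (2 : ℝ) + |B| * r₀ ^ p, fun r hr => ?_⟩
  have h1 : r ^ (2 : ℝ) ≤ r₀ ^ (2 : ℝ) := Real.rpow_le_rpow hr.1.le hr.2.le (by norm_num)
  have h2 : r ^ p ≤ r₀ ^ p := Real.rpow_le_rpow hr.1.le hr.2.le hp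
  have h3 : 0 ≤ r ^ (2 : ℝ) := Real.rpow_nonneg hr.1.le _
  have h4 : 0 ≤ r ^ p := Real.rpow_nonneg hr.1.le _
  have h5 : A * r ^ (2 : ℝ) ≤ |A| * r₀ ^ (2 : ℝ) :=
    (mul_le_mul_of_nonneg_right (le_abs_self A) h3).trans
      (mul_le_mul_of_nonneg_left h1 (abs_nonneg A))
  have h6 : -B * r ^ p ≤ |B| * r₀ ^ p :=
    (mul_le_mul_of_nonneg_right (neg_le_abs B) h4).trans
      (mul_le_mul_of_nonneg_left h2 (abs_nonneg B))
  linarith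

/-- If the coefficient of the leading term is negative, the potential is bounded above. -/
theorem exists_potential_le_of_neg (A B p : ℝ) (hp : 0 ≤ p) (hp2 : p < 2) (hA : A < 0) :
    ∃ c : ℝ, ∀ r ∈ Ioi 0, A * r ^ (2 : ℝ) - B * r ^ p ≤ c := by
  have hlim : Tendsto (fun r : ℝ => r ^ (p - 2)) atTop (𝓝 0) := by
    have := tendsto_rpow_neg_atTop (y := 2 - p) (by linarith)
    simpa using this
  -- The potential is `r²` times this expression, so it is nonpositive once the expression is
  -- negative; below that radius the bounded case applies.
  have hlim2 : Tendsto (fun r : ℝ => A - B * r ^ (p - 2)) atTop (𝓝 A) := by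
    simpa using tendsto_const_nhds.sub (hlim.const_mul B)
  obtain ⟨R, hR⟩ := eventually_atTop.1 (hlim2.eventually (gt_mem_nhds hA))
  obtain ⟨c, hc⟩ := exists_potential_le_of_bounded A B p (max R 1) hp
  refine ⟨max c 0, fun r hr => ?_⟩
  rcases lt_or_ge r (max R 1) with h | h
  · exact (hc r ⟨hr, h⟩).trans (le_max_left _ _)
  · refine le_trans ?_ (le_max_right _ _)
    have h1 := hR r ((le_max_left _ _).trans h)
    have h2 : r ^ p = r ^ (p - 2) * r ^ (2 : ℝ) := by
      rw [← Real.rpow_add hr]; norm_num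
    have h3 : 0 ≤ r ^ (2 : ℝ) := Real.rpow_nonneg (le_of_lt hr) _
    have h4 := mul_nonpos_of_nonpos_of_nonneg h1.le h3
    rw [h2]
    linarith

theorem potential_nonpos {A B p r : ℝ} (hr : 0 < r) (hA : A ≤ 0) (hB : 0 ≤ B) :
    A * r ^ (2 : ℝ) - B * r ^ p ≤ 0 := by
  have h1 := mul_nonneg hB (Real.rpow_nonneg hr.le p)
  have h2 := mul_nonpos_of_nonpos_of_nonneg hA (Real.rpow_nonneg hr.le 2)
  linarith

end Radial

/-! ### The metric and the gradient pairing under changes of charts. -/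

section Chart

variable {m : ℕ} {S : Type*} [TopologicalSpace S] [ChartedSpace (EuclideanSpace ℝ (Fin m)) S]

/-- The coordinate change from the chart around `x` to the chart around `y`. -/
noncomputable def chartChange (x y : S) : EuclideanSpace ℝ (Fin m) → EuclideanSpace ℝ (Fin m) :=
  extChartAt (𝓡 m) y ∘ (extChartAt (𝓡 m) x).symm

/-- The Jacobian matrix of the coordinate change. -/
noncomputable def chartJacobian (x y : S) (z : EuclideanSpace ℝ (Fin m)) :
    Matrix (Fin m) (Fin m) ℝ :=
  Matrix.of fun C A => fderiv ℝ (chartChange (m := m) x y) z (EuclideanSpace.single A (1 : ℝ)) C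

theorem det_chartJacobian (x y : S) (z : EuclideanSpace ℝ (Fin m)) :
    (chartJacobian (m := m) x y z).det = (fderiv ℝ (chartChange (m := m) x y) z).det := by
  rw [ContinuousLinearMap.det, ← LinearMap.det_toMatrix (EuclideanSpace.basisFun (Fin m) ℝ).toBasis]
  congr 1

theorem fderiv_chartChange_single (x y : S) (z : EuclideanSpace ℝ (Fin m)) (A : Fin m) :
    fderiv ℝ (chartChange (m := m) x y) z (EuclideanSpace.single A (1 : ℝ))
      = ∑ C, chartJacobian x y z C A • EuclideanSpace.single C (1 : ℝ) := by
  ext B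
  simp [Finset.sum_apply, Pi.single_apply, chartJacobian]

theorem chartChange_mem_target {x y : S} {z : EuclideanSpace ℝ (Fin m)}
    (hy : (extChartAt (𝓡 m) x).symm z ∈ (extChartAt (𝓡 m) y).source) :
    chartChange x y z ∈ (extChartAt (𝓡 m) y).target :=
  (extChartAt (𝓡 m) y).map_source hy

variable [IsManifold (𝓡 m) ∞ S]

theorem contMDiffOn_symm_chart (x : S) :
    ContMDiffOn (𝓡 m) (𝓡 m) ∞ (extChartAt (𝓡 m) x).symm (extChartAt (𝓡 m) x).target :=
  contMDiffOn_extChartAt_symm x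

theorem mdifferentiableAt_symm_chart {x : S} {z : EuclideanSpace ℝ (Fin m)}
    (hz : z ∈ (extChartAt (𝓡 m) x).target) :
    MDifferentiableAt (𝓡 m) (𝓡 m) (extChartAt (𝓡 m) x).symm z :=
  ((contMDiffOn_symm_chart x).contMDiffAt ((isOpen_extChartAt_target x).mem_nhds hz)).mdifferentiableAt
    (by simp)

/-- The coordinate field is the tangent map of the smooth inverse chart applied to a constant
section. -/
theorem contMDiffOn_coordVec (x : S) (A : Fin m) :
    ContMDiffOn (𝓡 m) (𝓡 m).tangent ∞
      (fun z => (⟨(extChartAt (𝓡 m) x).symm z, coordVec x z A⟩ : TangentBundle (𝓡 m) S))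
      (extChartAt (𝓡 m) x).target := by
  have ho := isOpen_extChartAt_target (I := 𝓡 m) x
  have h1 := (contMDiffOn_symm_chart (m := m) x).contMDiffOn_tangentMapWithin (m := ∞) (by simp)
    ho.uniqueMDiffOn
  have h2 : ContMDiff (𝓡 m) (𝓡 m).tangent ∞ (fun z : EuclideanSpace ℝ (Fin m) =>
      (⟨z, EuclideanSpace.single A (1 : ℝ)⟩ :
        TangentBundle (𝓡 m) (EuclideanSpace ℝ (Fin m)))) := by
    have := (contMDiff_vectorSpace_iff_contDiff (𝕜 := ℝ) (n := ∞)
      (V := fun z : EuclideanSpace ℝ (Fin m) => (EuclideanSpace.single A (1 : ℝ) :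
        TangentSpace 𝓘(ℝ, EuclideanSpace ℝ (Fin m)) z))).2 contDiff_const
    exact this
  have h3 := h1.comp h2.contMDiffOn (s := (extChartAt (𝓡 m) x).target) fun z hz => hz
  refine h3.congr fun z hz => ?_
  simp only [Function.comp_apply, tangentMapWithin, coordVec]
  rw [mfderivWithin_of_isOpen ho hz]

theorem contDiffOn_metricMatrix (G : Metric m S) (x : S) (A B : Fin m) :
    ContDiffOn ℝ ∞ (fun z => metricMatrix G x z A B) (extChartAt (𝓡 m) x).target := by
  rw [← contMDiffOn_iff_contDiffOn]
  intro z hz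
  have hb := contMDiffOn_symm_chart x z hz
  have : ContMDiffWithinAt (𝓡 m) ((𝓡 m).prod 𝓘(ℝ)) ∞
      (fun z => Bundle.TotalSpace.mk' ℝ (E := Bundle.Trivial S ℝ) ((extChartAt (𝓡 m) x).symm z)
        (G.inner ((extChartAt (𝓡 m) x).symm z) (coordVec x z A) (coordVec x z B)))
      (extChartAt (𝓡 m) x).target z := by
    apply ContMDiffWithinAt.clm_bundle_apply₂ (F₁ := EuclideanSpace ℝ (Fin m))
      (F₂ := EuclideanSpace ℝ (Fin m))
    · exact ContMDiffAt.comp_contMDiffWithinAt z G.contMDiff.contMDiffAt hb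
    · exact contMDiffOn_coordVec x A z hz
    · exact contMDiffOn_coordVec x B z hz
  rw [Bundle.contMDiffWithinAt_totalSpace] at this
  exact this.2


theorem mdifferentiableAt_chart {x p : S} (hp : p ∈ (extChartAt (𝓡 m) x).source) :
    MDifferentiableAt (𝓡 m) (𝓡 m) (extChartAt (𝓡 m) x) p :=
  (contMDiffAt_extChartAt' (I := 𝓡 m) (n := ∞)
    (by rwa [extChartAt_source] at hp)).mdifferentiableAt (by simp)

/-- The metric in the chart around `x`, as a function of two vectors. -/
theorem sum_metricMatrix (G : Metric m S) (x : S) (z v : EuclideanSpace ℝ (Fin m)) :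
    ∑ A, ∑ B, v A * (metricMatrix G x z A B * v B)
      = G.inner ((extChartAt (𝓡 m) x).symm z)
        (mfderiv (𝓡 m) (𝓡 m) (extChartAt (𝓡 m) x).symm z v)
        (mfderiv (𝓡 m) (𝓡 m) (extChartAt (𝓡 m) x).symm z v) := by
  have hv : v = ∑ A, v A • EuclideanSpace.single A (1 : ℝ) := by
    ext B
    simp [Finset.sum_apply, Pi.single_apply]
  have h : mfderiv (𝓡 m) (𝓡 m) (extChartAt (𝓡 m) x).symm z v = ∑ A, v A • coordVec x z A := by
    conv_lhs => rw [hv]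
    exact (map_sum _ _ _).trans (Finset.sum_congr rfl fun A _ => map_smul _ _ _)
  rw [h]
  simp only [map_sum, map_smul, FunLike.coe_sum, FunLike.coe_smul, Finset.sum_apply, Pi.smul_apply,
    smul_eq_mul, Finset.mul_sum]
  rw [Finset.sum_comm]
  refine Finset.sum_congr rfl fun A _ => Finset.sum_congr rfl fun B _ => ?_
  simp only [metricMatrix, Matrix.of_apply]
  rw [G.symm _ (coordVec x z B)]
  ring

/-- The derivative of the inverse chart is invertible, so a nonzero coordinate vector goes to a
nonzero tangent vector, on which `G` is positive. -/
theorem posDef_metricMatrix (G : Metric m S) (x : S) {z : EuclideanSpace ℝ (Fin m)}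
    (hz : z ∈ (extChartAt (𝓡 m) x).target) : (metricMatrix G x z).PosDef := by
  refine Matrix.PosDef.of_dotProduct_mulVec_pos ?_ fun v hv => ?_
  · ext A B
    simp only [Matrix.conjTranspose_apply, metricMatrix, Matrix.of_apply, star_trivial]
    exact G.symm _ _ _
  · have h := sum_metricMatrix G x z (WithLp.toLp 2 v)
    have hne : mfderiv (𝓡 m) (𝓡 m) (extChartAt (𝓡 m) x).symm z (WithLp.toLp 2 v) ≠ 0 := by
      have hinv : (mfderiv (𝓡 m) (𝓡 m) (extChartAt (𝓡 m) x).symm z).IsInvertible := by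
        have := isInvertible_mfderivWithin_extChartAt_symm (I := 𝓡 m) hz
        rwa [ModelWithCorners.range_eq_univ, mfderivWithin_univ] at this
      intro h0
      have := hinv.injective (h0.trans (map_zero _).symm)
      exact hv ((WithLp.toLp_eq_zero 2).1 this)
    have hpos := G.pos _ _ hne
    rw [← h] at hpos
    simpa [dotProduct, Matrix.mulVec, Finset.mul_sum] using hpos

theorem det_metricMatrix_pos (G : Metric m S) (x : S) {z : EuclideanSpace ℝ (Fin m)}
    (hz : z ∈ (extChartAt (𝓡 m) x).target) : 0 < (metricMatrix G x z).det :=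
  (posDef_metricMatrix G x hz).det_pos

theorem volDensity_pos (G : Metric m S) (x : S) {z : EuclideanSpace ℝ (Fin m)}
    (hz : z ∈ (extChartAt (𝓡 m) x).target) : 0 < volDensity G x z :=
  Real.sqrt_pos.2 (det_metricMatrix_pos G x hz)

theorem contDiffOn_det {n : ℕ∞ω} {X ι : Type*} [Fintype ι] [DecidableEq ι] [NormedAddCommGroup X]
    [NormedSpace ℝ X] {M : X → Matrix ι ι ℝ} {s : Set X}
    (hM : ∀ A B, ContDiffOn ℝ n (fun z => M z A B) s) : ContDiffOn ℝ n (fun z => (M z).det) s := by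
  simp only [Matrix.det_apply]
  exact ContDiffOn.sum fun σ _ => (contDiffOn_prod fun i _ => hM _ _).const_smul _

theorem contDiffOn_volDensity (G : Metric m S) (x : S) :
    ContDiffOn ℝ ∞ (volDensity G x) (extChartAt (𝓡 m) x).target :=
  (contDiffOn_det (contDiffOn_metricMatrix G x)).sqrt fun _ hz => (det_metricMatrix_pos G x hz).ne'

theorem contDiffOn_metricMatrix_inv (G : Metric m S) (x : S) (A B : Fin m) :
    ContDiffOn ℝ ∞ (fun z => (metricMatrix G x z)⁻¹ A B) (extChartAt (𝓡 m) x).target := by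
  -- Cramer's rule: entries of the adjugate are determinants of matrices with smooth entries.
  have h : ContDiffOn ℝ ∞ (fun z => ((metricMatrix G x z).det)⁻¹ * (metricMatrix G x z).adjugate A B)
      (extChartAt (𝓡 m) x).target := by
    refine ((contDiffOn_det (contDiffOn_metricMatrix G x)).inv
      fun z hz => (det_metricMatrix_pos G x hz).ne').mul ?_
    simp only [Matrix.adjugate_apply]
    refine contDiffOn_det fun C D => ?_
    by_cases h : C = B
    · subst h
      simp only [Matrix.updateRow_self]
      exact contDiffOn_const
    · simp only [Matrix.updateRow_ne h]
      exact contDiffOn_metricMatrix G x C D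
  refine h.congr fun z _ => ?_
  rw [Matrix.inv_def, Matrix.smul_apply, Ring.inverse_eq_inv', smul_eq_mul]

theorem differentiableAt_chartChange {x y : S} {z : EuclideanSpace ℝ (Fin m)}
    (hz : z ∈ (extChartAt (𝓡 m) x).target)
    (hy : (extChartAt (𝓡 m) x).symm z ∈ (extChartAt (𝓡 m) y).source) :
    DifferentiableAt ℝ (chartChange (m := m) x y) z := by
  rw [← mdifferentiableAt_iff_differentiableAt]
  exact (mdifferentiableAt_chart hy).comp z (mdifferentiableAt_symm_chart hz)

theorem symm_chart_eventuallyEq {x y : S} {z : EuclideanSpace ℝ (Fin m)}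
    (hz : z ∈ (extChartAt (𝓡 m) x).target)
    (hy : (extChartAt (𝓡 m) x).symm z ∈ (extChartAt (𝓡 m) y).source) :
    (extChartAt (𝓡 m) x).symm =ᶠ[𝓝 z] (extChartAt (𝓡 m) y).symm ∘ chartChange x y := by
  filter_upwards [((mdifferentiableAt_symm_chart hz).continuousAt).preimage_mem_nhds
    ((isOpen_extChartAt_source y).mem_nhds hy)] with w hw
  exact ((extChartAt (𝓡 m) y).left_inv hw).symm

theorem bilinear_sum_smul {ι X : Type*} [Fintype ι] [AddCommGroup X] [Module ℝ X]
    [TopologicalSpace X] (g : X →L[ℝ] X →L[ℝ] ℝ) (a b : ι → ℝ) (v w : ι → X) :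
    g (∑ C, a C • v C) (∑ D, b D • w D) = ∑ C, ∑ D, a C * b D * g (v C) (w D) := by
  simp only [map_sum, map_smul, FunLike.coe_sum, FunLike.coe_smul,
    Finset.sum_apply, Pi.smul_apply, smul_eq_mul, Finset.mul_sum]
  rw [Finset.sum_comm]
  refine Finset.sum_congr rfl fun C _ => Finset.sum_congr rfl fun D _ => ?_
  ring

theorem sum_sum_congruence {ι : Type*} [Fintype ι] (N J : Matrix ι ι ℝ) (b b' : ι → ℂ) :
    ∑ A, ∑ B, (N A B : ℂ) * ((∑ C, (J C A : ℂ) * b C) * ∑ D, (J D B : ℂ) * b' D)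
      = ∑ C, ∑ D, ((J * N * J.transpose) C D : ℂ) * (b C * b' D) := by
  have h : ∀ (P : Matrix ι ι ℂ) (v w : ι → ℂ),
      ∑ A, ∑ B, P A B * (v A * w B) = v ⬝ᵥ (P.mulVec w) := by
    intro P v w
    simp only [dotProduct, Matrix.mulVec, Finset.mul_sum]
    exact Finset.sum_congr rfl fun A _ => Finset.sum_congr rfl fun B _ => by ring
  let c : ℝ →+* ℂ := Complex.ofRealHom
  have h1 := h (N.map c) (fun A => ∑ C, (J C A : ℂ) * b C) (fun B => ∑ D, (J D B : ℂ) * b' D)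
  have h2 := h ((J * N * J.transpose).map c) b b'
  refine h1.trans (Eq.trans ?_ h2.symm)
  have h3 : (fun A => ∑ C, (J C A : ℂ) * b C) = Matrix.vecMul b (J.map c) := by
    ext A
    exact Finset.sum_congr rfl fun C _ => mul_comm _ _
  have h4 : (fun B => ∑ D, (J D B : ℂ) * b' D) = (J.map c).transpose.mulVec b' := by
    ext A
    rfl
  rw [h3, h4, ← Matrix.dotProduct_mulVec, Matrix.mulVec_mulVec, Matrix.mulVec_mulVec,
    Matrix.map_mul, Matrix.map_mul, Matrix.transpose_map, mul_assoc]

/-- Chain rule for the local factorization of the inverse chart at `x` through the chart at `y`.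
Vectors are viewed in the model space because the base points on the two sides agree only
propositionally. -/
theorem coordVec_eq_sum {x y : S} {z : EuclideanSpace ℝ (Fin m)}
    (hz : z ∈ (extChartAt (𝓡 m) x).target)
    (hy : (extChartAt (𝓡 m) x).symm z ∈ (extChartAt (𝓡 m) y).source) (A : Fin m) :
    (coordVec x z A : EuclideanSpace ℝ (Fin m))
      = ∑ C, chartJacobian x y z C A •
        (coordVec y (chartChange x y z) C : EuclideanSpace ℝ (Fin m)) := by
  have h1 : mfderiv (𝓡 m) (𝓡 m) (extChartAt (𝓡 m) x).symm z
      = mfderiv (𝓡 m) (𝓡 m) ((extChartAt (𝓡 m) y).symm ∘ chartChange x y) z :=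
    (symm_chart_eventuallyEq hz hy).mfderiv_eq
  have h2 := mfderiv_comp z (mdifferentiableAt_symm_chart (chartChange_mem_target hy))
    (mdifferentiableAt_iff_differentiableAt.2 (differentiableAt_chartChange hz hy))
  have h3 : (coordVec x z A : EuclideanSpace ℝ (Fin m))
      = mfderiv (𝓡 m) (𝓡 m) (extChartAt (𝓡 m) y).symm (chartChange x y z)
        (fderiv ℝ (chartChange (m := m) x y) z (EuclideanSpace.single A (1 : ℝ))) := by
    rw [← mfderiv_eq_fderiv]
    exact congrArg (fun L : EuclideanSpace ℝ (Fin m) →L[ℝ] EuclideanSpace ℝ (Fin m) =>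
      L (EuclideanSpace.single A (1 : ℝ))) (h1.trans h2)
  rw [h3, fderiv_chartChange_single]
  exact (map_sum _ _ _).trans (Finset.sum_congr rfl fun C _ => map_smul _ _ _)

theorem metricMatrix_eq (G : Metric m S) {x y : S} {z : EuclideanSpace ℝ (Fin m)}
    (hz : z ∈ (extChartAt (𝓡 m) x).target)
    (hy : (extChartAt (𝓡 m) x).symm z ∈ (extChartAt (𝓡 m) y).source) :
    metricMatrix G x z = (chartJacobian x y z).transpose
      * metricMatrix G y (chartChange x y z) * chartJacobian x y z := by
  have hp : (extChartAt (𝓡 m) y).symm (chartChange x y z) = (extChartAt (𝓡 m) x).symm z :=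
    (extChartAt (𝓡 m) y).left_inv hy
  let g : S → EuclideanSpace ℝ (Fin m) →L[ℝ] EuclideanSpace ℝ (Fin m) →L[ℝ] ℝ :=
    fun p => G.inner p
  ext A B
  change g ((extChartAt (𝓡 m) x).symm z) (coordVec x z A : EuclideanSpace ℝ (Fin m))
    (coordVec x z B : EuclideanSpace ℝ (Fin m)) = _
  rw [← hp, coordVec_eq_sum hz hy A, coordVec_eq_sum hz hy B]
  refine (bilinear_sum_smul (g _) _ _ (fun C => (coordVec y (chartChange x y z) C :
    EuclideanSpace ℝ (Fin m))) (fun C => (coordVec y (chartChange x y z) C :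
    EuclideanSpace ℝ (Fin m)))).trans ?_
  simp only [Matrix.mul_apply, Matrix.transpose_apply, Finset.sum_mul]
  rw [Finset.sum_comm]
  refine Finset.sum_congr rfl fun D _ => Finset.sum_congr rfl fun C _ => ?_
  change _ = _ * g ((extChartAt (𝓡 m) y).symm (chartChange x y z)) _ _ * _
  ring

theorem volDensity_eq (G : Metric m S) {x y : S} {z : EuclideanSpace ℝ (Fin m)}
    (hz : z ∈ (extChartAt (𝓡 m) x).target)
    (hy : (extChartAt (𝓡 m) x).symm z ∈ (extChartAt (𝓡 m) y).source) :
    volDensity G x z = |(fderiv ℝ (chartChange (m := m) x y) z).det|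
      * volDensity G y (chartChange x y z) := by
  rw [volDensity, volDensity, metricMatrix_eq G hz hy, Matrix.det_mul, Matrix.det_mul,
    Matrix.det_transpose, ← det_chartJacobian, ← Real.sqrt_sq_eq_abs,
    ← Real.sqrt_mul (sq_nonneg _)]
  congr 1
  ring

/-- Invert `M = Jᵀ N J`. The Jacobian is invertible because `det M = (det J)² det N` is positive. -/
theorem metricMatrix_inv_eq (G : Metric m S) {x y : S} {z : EuclideanSpace ℝ (Fin m)}
    (hz : z ∈ (extChartAt (𝓡 m) x).target)
    (hy : (extChartAt (𝓡 m) x).symm z ∈ (extChartAt (𝓡 m) y).source) :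
    (metricMatrix G y (chartChange x y z))⁻¹ = chartJacobian x y z * (metricMatrix G x z)⁻¹
      * (chartJacobian x y z).transpose := by
  have hM := metricMatrix_eq G hz hy
  have hd := det_metricMatrix_pos G x hz
  set J := chartJacobian (m := m) x y z
  set N := metricMatrix G y (chartChange x y z)
  set M := metricMatrix G x z
  have hdet : M.det = J.det * N.det * J.det := by
    rw [hM, Matrix.det_mul, Matrix.det_mul, Matrix.det_transpose]
  have hJ : IsUnit J.det := by
    refine isUnit_iff_ne_zero.2 fun h => ?_
    rw [hdet, h] at hd
    simp at hd
  have hJt : IsUnit J.transpose.det := by rwa [Matrix.det_transpose]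
  rw [hM, Matrix.mul_inv_rev, Matrix.mul_inv_rev, ← mul_assoc, Matrix.mul_nonsing_inv _ hJ,
    one_mul, mul_assoc, Matrix.nonsing_inv_mul _ hJt, mul_one]

/-- The expression `G^{AB} ∂_A F ∂_B H` in the chart around `x`. -/
noncomputable def chartPairing (G : Metric m S) (x : S) (F H : EuclideanSpace ℝ (Fin m) → ℂ)
    (z : EuclideanSpace ℝ (Fin m)) : ℂ :=
  ∑ A, ∑ B, ((metricMatrix G x z)⁻¹ A B : ℂ) *
    (fderiv ℝ F z (EuclideanSpace.single A (1 : ℝ))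
      * fderiv ℝ H z (EuclideanSpace.single B (1 : ℝ)))

/-- The expression `G^{AB} ∂_A f ∂_B h` as a function on `S`. -/
noncomputable def gradPairing (G : Metric m S) (f h : S → ℂ) (p : S) : ℂ :=
  chartPairing G p (f ∘ (extChartAt (𝓡 m) p).symm) (h ∘ (extChartAt (𝓡 m) p).symm)
    (extChartAt (𝓡 m) p p)

theorem differentiableAt_comp_symm_chart {f : S → ℂ} (hf : ContMDiff (𝓡 m) 𝓘(ℝ, ℂ) ∞ f) {x : S}
    {z : EuclideanSpace ℝ (Fin m)} (hz : z ∈ (extChartAt (𝓡 m) x).target) :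
    DifferentiableAt ℝ (f ∘ (extChartAt (𝓡 m) x).symm) z := by
  rw [← mdifferentiableAt_iff_differentiableAt]
  exact (hf.mdifferentiableAt (by simp)).comp z (mdifferentiableAt_symm_chart hz)

theorem contDiffOn_comp_symm_chart {f : S → ℂ} (hf : ContMDiff (𝓡 m) 𝓘(ℝ, ℂ) ∞ f) (x : S) :
    ContDiffOn ℝ ∞ (f ∘ (extChartAt (𝓡 m) x).symm) (extChartAt (𝓡 m) x).target := by
  rw [← contMDiffOn_iff_contDiffOn]
  exact hf.comp_contMDiffOn (contMDiffOn_symm_chart x)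

theorem fderiv_comp_symm_chart {f : S → ℂ} (hf : ContMDiff (𝓡 m) 𝓘(ℝ, ℂ) ∞ f) {x y : S}
    {z : EuclideanSpace ℝ (Fin m)} (hz : z ∈ (extChartAt (𝓡 m) x).target)
    (hy : (extChartAt (𝓡 m) x).symm z ∈ (extChartAt (𝓡 m) y).source) (A : Fin m) :
    fderiv ℝ (f ∘ (extChartAt (𝓡 m) x).symm) z (EuclideanSpace.single A (1 : ℝ))
      = ∑ C, (chartJacobian x y z C A : ℂ) *
        fderiv ℝ (f ∘ (extChartAt (𝓡 m) y).symm) (chartChange x y z)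
          (EuclideanSpace.single C (1 : ℝ)) := by
  have h1 : f ∘ (extChartAt (𝓡 m) x).symm =ᶠ[𝓝 z]
      (f ∘ (extChartAt (𝓡 m) y).symm) ∘ chartChange x y :=
    (symm_chart_eventuallyEq hz hy).fun_comp f
  rw [h1.fderiv_eq, fderiv_comp z (differentiableAt_comp_symm_chart hf (chartChange_mem_target hy))
    (differentiableAt_chartChange hz hy), ContinuousLinearMap.comp_apply,
    fderiv_chartChange_single]
  simp [map_sum]

/-- Differentials transform by `Jᵀ` and the inverse metric by `J M⁻¹ Jᵀ`, so the contraction is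
invariant. Thus `gradPairing`, which uses a different chart at each point, is computed in any single
chart. -/
theorem chartPairing_eq (G : Metric m S) {f h : S → ℂ} (hf : ContMDiff (𝓡 m) 𝓘(ℝ, ℂ) ∞ f)
    (hh : ContMDiff (𝓡 m) 𝓘(ℝ, ℂ) ∞ h) {x y : S}
    {z : EuclideanSpace ℝ (Fin m)} (hz : z ∈ (extChartAt (𝓡 m) x).target)
    (hy : (extChartAt (𝓡 m) x).symm z ∈ (extChartAt (𝓡 m) y).source) :
    chartPairing G x (f ∘ (extChartAt (𝓡 m) x).symm) (h ∘ (extChartAt (𝓡 m) x).symm) z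
      = chartPairing G y (f ∘ (extChartAt (𝓡 m) y).symm) (h ∘ (extChartAt (𝓡 m) y).symm)
        (chartChange x y z) := by
  unfold chartPairing
  simp only [fderiv_comp_symm_chart hf hz hy, fderiv_comp_symm_chart hh hz hy,
    metricMatrix_inv_eq G hz hy]
  exact sum_sum_congruence _ _ _ _

theorem gradPairing_symm_chart (G : Metric m S) {f h : S → ℂ} (hf : ContMDiff (𝓡 m) 𝓘(ℝ, ℂ) ∞ f)
    (hh : ContMDiff (𝓡 m) 𝓘(ℝ, ℂ) ∞ h) {x : S}
    {z : EuclideanSpace ℝ (Fin m)} (hz : z ∈ (extChartAt (𝓡 m) x).target) :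
    gradPairing G f h ((extChartAt (𝓡 m) x).symm z)
      = chartPairing G x (f ∘ (extChartAt (𝓡 m) x).symm) (h ∘ (extChartAt (𝓡 m) x).symm) z :=
  (chartPairing_eq G hf hh hz (mem_extChartAt_source _)).symm

end Chart

/-! ### Integration against the Riemannian volume. -/

section Volume

variable {m : ℕ} {S : Type*} [TopologicalSpace S] [ChartedSpace (EuclideanSpace ℝ (Fin m)) S]

theorem isCompact_image_chart [CompactSpace S] {x : S} {K : Set S} (hK : IsClosed K)
    (hKx : K ⊆ (extChartAt (𝓡 m) x).source) : IsCompact (extChartAt (𝓡 m) x '' K) :=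
  hK.isCompact.image_of_continuousOn ((continuousOn_extChartAt x).mono hKx)

theorem image_chart_subset_target {x : S} {K : Set S}
    (hKx : K ⊆ (extChartAt (𝓡 m) x).source) :
    extChartAt (𝓡 m) x '' K ⊆ (extChartAt (𝓡 m) x).target := by
  rintro _ ⟨p, hp, rfl⟩
  exact (extChartAt (𝓡 m) x).map_source (hKx hp)

theorem symm_chart_notMem {x : S} {K : Set S} {z : EuclideanSpace ℝ (Fin m)}
    (hz : z ∈ (extChartAt (𝓡 m) x).target) (hzK : z ∉ extChartAt (𝓡 m) x '' K) :
    (extChartAt (𝓡 m) x).symm z ∉ K :=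
  fun h => hzK ⟨_, h, (extChartAt (𝓡 m) x).right_inv hz⟩

/-- Nothing controls `h` near the boundary of the chart target, but the image of the closed set `K`
is compact there and `h` vanishes off it. -/
theorem integrableOn_chart [CompactSpace S] {F : Type*} [NormedAddCommGroup F] {x : S} {K : Set S}
    (hK : IsClosed K) (hKx : K ⊆ (extChartAt (𝓡 m) x).source)
    {h : EuclideanSpace ℝ (Fin m) → F} (hc : ContinuousOn h (extChartAt (𝓡 m) x).target)
    (h0 : ∀ z ∈ (extChartAt (𝓡 m) x).target, (extChartAt (𝓡 m) x).symm z ∉ K → h z = 0) :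
    IntegrableOn h (extChartAt (𝓡 m) x).target :=
  ((hc.mono (image_chart_subset_target hKx)).integrableOn_compact
    (isCompact_image_chart hK hKx)).of_forall_sdiff_eq_zero
      (isOpen_extChartAt_target x).measurableSet fun z hz => h0 z hz.1 (symm_chart_notMem hz.1 hz.2)

theorem continuousOn_comp_symm_chart {F : Type*} [TopologicalSpace F] {x : S} {k : S → F}
    (hk : ContinuousOn k (extChartAt (𝓡 m) x).source) :
    ContinuousOn (fun z => k ((extChartAt (𝓡 m) x).symm z)) (extChartAt (𝓡 m) x).target :=
  hk.comp (continuousOn_extChartAt_symm x) fun _ hz => (extChartAt (𝓡 m) x).map_target hz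

variable [IsManifold (𝓡 m) ∞ S] [T2Space S] [CompactSpace S]

theorem tsupport_partitionOfUnity_subset (x : S) :
    tsupport (partitionOfUnity m S x) ⊆ (extChartAt (𝓡 m) x).source := by
  rw [extChartAt_source]
  exact (SmoothPartitionOfUnity.exists_isSubordinate_chartAt_source (𝓡 m) S).choose_spec x

theorem exists_finset_partitionOfUnity (m : ℕ) (S : Type*) [TopologicalSpace S]
    [ChartedSpace (EuclideanSpace ℝ (Fin m)) S] [IsManifold (𝓡 m) ∞ S] [T2Space S]
    [CompactSpace S] : ∃ s : Finset S, (∀ x ∉ s, ∀ p, partitionOfUnity m S x p = 0) ∧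
      ∀ p, ∑ x ∈ s, partitionOfUnity m S x p = 1 := by
  have hfin := (partitionOfUnity m S).locallyFinite.finite_nonempty_of_compact
  have h0 : ∀ x ∉ hfin.toFinset, ∀ p, partitionOfUnity m S x p = 0 := by
    intro x hx p
    by_contra h
    exact hx (hfin.mem_toFinset.2 ⟨p, h⟩)
  refine ⟨hfin.toFinset, h0, fun p => ?_⟩
  refine (partitionOfUnity m S).sum_finsupport' p (mem_univ p) fun x hx => ?_
  by_contra h
  exact ((partitionOfUnity m S).mem_finsupport p).1 hx (h0 x h p)

/-- The density of the contribution of the chart around `x` to the volume measure. -/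
noncomputable def chartWeight (G : Metric m S) (x : S) (z : EuclideanSpace ℝ (Fin m)) : ℝ :=
  partitionOfUnity m S x ((extChartAt (𝓡 m) x).symm z) * volDensity G x z

theorem chartWeight_nonneg (G : Metric m S) (x : S) (z : EuclideanSpace ℝ (Fin m)) :
    0 ≤ chartWeight G x z :=
  mul_nonneg ((partitionOfUnity m S).nonneg x _) (Real.sqrt_nonneg _)

theorem continuousOn_chartWeight (G : Metric m S) (x : S) :
    ContinuousOn (chartWeight G x) (extChartAt (𝓡 m) x).target :=
  (continuousOn_comp_symm_chart (partitionOfUnity m S x).contMDiff.continuous.continuousOn).mul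
    (contDiffOn_volDensity G x).continuousOn

theorem integrableOn_chartWeight (G : Metric m S) (x : S) :
    IntegrableOn (chartWeight G x) (extChartAt (𝓡 m) x).target :=
  integrableOn_chart (isClosed_tsupport _) (tsupport_partitionOfUnity_subset x)
    (continuousOn_chartWeight G x) fun z _ h => by
      rw [chartWeight, image_eq_zero_of_notMem_tsupport h, zero_mul]

/-- Change of variables between the charts around `x` and `y`. -/
theorem setIntegral_chartWeight_eq (G : Metric m S) (x y : S) {k : S → ℂ}
    (hk : ∀ p ∉ (extChartAt (𝓡 m) x).source, k p = 0) :
    ∫ z in (extChartAt (𝓡 m) y).target,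
        (chartWeight G y z : ℂ) * k ((extChartAt (𝓡 m) y).symm z)
      = ∫ z in (extChartAt (𝓡 m) x).target,
        (volDensity G x z : ℂ) * (partitionOfUnity m S y ((extChartAt (𝓡 m) x).symm z)
          * k ((extChartAt (𝓡 m) x).symm z)) := by
  -- `B` is the overlap of the two charts in the coordinates of `x`. Off the overlap both integrands
  -- vanish, one because of `k`, the other because of the partition function of `y`.
  set B := (extChartAt (𝓡 m) x).target ∩
    (extChartAt (𝓡 m) x).symm ⁻¹' (extChartAt (𝓡 m) y).source with hB
  have hBm : MeasurableSet B :=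
    ((continuousOn_extChartAt_symm x).isOpen_inter_preimage (isOpen_extChartAt_target x)
      (isOpen_extChartAt_source y)).measurableSet
  have hinj : InjOn (chartChange (m := m) x y) B := by
    intro z hz w hw h
    have h1 := (extChartAt (𝓡 m) y).injOn hz.2 hw.2 h
    exact (extChartAt (𝓡 m) x).symm.injOn hz.1 hw.1 h1
  have himage : chartChange x y '' B = (extChartAt (𝓡 m) y).target ∩
      (extChartAt (𝓡 m) y).symm ⁻¹' (extChartAt (𝓡 m) x).source := by
    ext w
    constructor
    · rintro ⟨z, hz, rfl⟩
      refine ⟨chartChange_mem_target hz.2, ?_⟩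
      have : (extChartAt (𝓡 m) y).symm (chartChange x y z) = (extChartAt (𝓡 m) x).symm z :=
        (extChartAt (𝓡 m) y).left_inv hz.2
      rw [mem_preimage, this]
      exact (extChartAt (𝓡 m) x).map_target hz.1
    · rintro ⟨hw, hwx⟩
      have hx : (extChartAt (𝓡 m) x).symm (extChartAt (𝓡 m) x ((extChartAt (𝓡 m) y).symm w))
          = (extChartAt (𝓡 m) y).symm w := (extChartAt (𝓡 m) x).left_inv hwx
      refine ⟨extChartAt (𝓡 m) x ((extChartAt (𝓡 m) y).symm w),
        ⟨(extChartAt (𝓡 m) x).map_source hwx, ?_⟩, ?_⟩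
      · rw [mem_preimage, hx]
        exact (extChartAt (𝓡 m) y).map_target hw
      · rw [chartChange, Function.comp_apply, hx, (extChartAt (𝓡 m) y).right_inv hw]
  have h1 : ∫ z in (extChartAt (𝓡 m) y).target,
        (chartWeight G y z : ℂ) * k ((extChartAt (𝓡 m) y).symm z)
      = ∫ z in chartChange x y '' B,
        (chartWeight G y z : ℂ) * k ((extChartAt (𝓡 m) y).symm z) := by
    rw [himage]
    refine setIntegral_eq_of_subset_of_forall_sdiff_eq_zero
      (isOpen_extChartAt_target y).measurableSet inter_subset_left fun z hz => ?_
    rw [hk _ fun h => hz.2 ⟨hz.1, h⟩, mul_zero]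
  have h2 : ∫ z in (extChartAt (𝓡 m) x).target,
        (volDensity G x z : ℂ) * (partitionOfUnity m S y ((extChartAt (𝓡 m) x).symm z)
          * k ((extChartAt (𝓡 m) x).symm z))
      = ∫ z in B, (volDensity G x z : ℂ) * (partitionOfUnity m S y ((extChartAt (𝓡 m) x).symm z)
          * k ((extChartAt (𝓡 m) x).symm z)) := by
    refine setIntegral_eq_of_subset_of_forall_sdiff_eq_zero
      (isOpen_extChartAt_target x).measurableSet inter_subset_left fun z hz => ?_
    rw [image_eq_zero_of_notMem_tsupport fun h => hz.2 ⟨hz.1, tsupport_partitionOfUnity_subset y h⟩]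
    simp
  rw [h1, h2, integral_image_eq_integral_abs_det_fderiv_smul volume hBm
    (fun z hz => (differentiableAt_chartChange hz.1 hz.2).hasFDerivAt.hasFDerivWithinAt) hinj]
  refine setIntegral_congr_fun hBm fun z hz => ?_
  have h3 : (extChartAt (𝓡 m) y).symm (chartChange x y z) = (extChartAt (𝓡 m) x).symm z :=
    (extChartAt (𝓡 m) y).left_inv hz.2
  simp only [chartWeight, h3, volDensity_eq G hz.1 hz.2, Complex.real_smul, Complex.ofReal_mul]
  ring

variable [MeasurableSpace S]

/-- The contribution of the chart around `x` to the volume measure. -/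
noncomputable def chartVolume (G : Metric m S) (x : S) : Measure S :=
  ((volume.restrict (extChartAt (𝓡 m) x).target).withDensity fun z =>
    ENNReal.ofReal (chartWeight G x z)).map (extChartAt (𝓡 m) x).symm

theorem riemannianVolume_eq_sum (G : Metric m S) {s : Finset S}
    (hs : ∀ x ∉ s, ∀ p, partitionOfUnity m S x p = 0) :
    riemannianVolume G = ∑ x ∈ s, chartVolume G x := by
  ext t ht
  rw [riemannianVolume, Measure.sum_apply _ ht, tsum_eq_sum (s := s), Measure.finsetSum_apply]
  · rfl
  · intro x hx
    simp [hs x hx]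

theorem isFiniteMeasure_chartVolume (G : Metric m S) (x : S) :
    IsFiniteMeasure (chartVolume G x) := by
  have : IsFiniteMeasure ((volume.restrict (extChartAt (𝓡 m) x).target).withDensity fun z =>
      ENNReal.ofReal (chartWeight G x z)) :=
    isFiniteMeasure_withDensity_ofReal (integrableOn_chartWeight G x).2
  unfold chartVolume
  infer_instance

theorem isFiniteMeasure_riemannianVolume (G : Metric m S) :
    IsFiniteMeasure (riemannianVolume G) := by
  obtain ⟨s, hs, -⟩ := exists_finset_partitionOfUnity m S
  have := fun x => isFiniteMeasure_chartVolume G x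
  rw [riemannianVolume_eq_sum G hs]
  infer_instance

variable [BorelSpace S]

theorem aemeasurable_symm_chart (G : Metric m S) (x : S) :
    AEMeasurable (extChartAt (𝓡 m) x).symm
      ((volume.restrict (extChartAt (𝓡 m) x).target).withDensity fun z =>
        ENNReal.ofReal (chartWeight G x z)) :=
  ((continuousOn_extChartAt_symm x).aemeasurable
    (isOpen_extChartAt_target x).measurableSet).mono_ac (withDensity_absolutelyContinuous _ _)

theorem Continuous.integrable_of_isFiniteMeasure {X : Type*} [TopologicalSpace X] [CompactSpace X]
    [MeasurableSpace X] [BorelSpace X] {μ : Measure X} [IsFiniteMeasure μ] {k : X → ℂ}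
    (hk : Continuous k) : Integrable k μ := by
  obtain ⟨C, hC⟩ := isCompact_univ.exists_bound_of_continuousOn hk.continuousOn
  exact Integrable.of_bound hk.aestronglyMeasurable C (Eventually.of_forall fun p => hC p trivial)

theorem integral_chartVolume (G : Metric m S) (x : S) {k : S → ℂ} (hk : Continuous k) :
    ∫ p, k p ∂chartVolume G x = ∫ z in (extChartAt (𝓡 m) x).target,
      (chartWeight G x z : ℂ) * k ((extChartAt (𝓡 m) x).symm z) := by
  rw [chartVolume, integral_map (aemeasurable_symm_chart G x) hk.aestronglyMeasurable,
    integral_withDensity_eq_integral_toReal_smul₀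
      (((continuousOn_chartWeight G x).aemeasurable
        (isOpen_extChartAt_target x).measurableSet).ennreal_ofReal) (by simp)]
  simp only [ENNReal.toReal_ofReal (chartWeight_nonneg G x _), Complex.real_smul]

theorem integral_riemannianVolume (G : Metric m S) {s : Finset S}
    (hs : ∀ x ∉ s, ∀ p, partitionOfUnity m S x p = 0) {k : S → ℂ} (hk : Continuous k) :
    ∫ p, k p ∂riemannianVolume G = ∑ x ∈ s, ∫ z in (extChartAt (𝓡 m) x).target,
      (chartWeight G x z : ℂ) * k ((extChartAt (𝓡 m) x).symm z) := by
  have := fun x => isFiniteMeasure_chartVolume G x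
  rw [riemannianVolume_eq_sum G hs, integral_finsetSum_measure
    fun x _ => Continuous.integrable_of_isFiniteMeasure hk]
  exact Finset.sum_congr rfl fun x _ => integral_chartVolume G x hk

/-- The integral of a function supported in a chart. -/
theorem integral_eq_setIntegral_chart (G : Metric m S) {x : S} {k : S → ℂ} (hk : Continuous k)
    (hkx : tsupport k ⊆ (extChartAt (𝓡 m) x).source) :
    ∫ p, k p ∂riemannianVolume G = ∫ z in (extChartAt (𝓡 m) x).target,
      (volDensity G x z : ℂ) * k ((extChartAt (𝓡 m) x).symm z) := by
  obtain ⟨s, hs, hs1⟩ := exists_finset_partitionOfUnity m S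
  rw [integral_riemannianVolume G hs hk]
  -- Every contribution is moved to the chart around `x`, where the partition functions sum to `1`.
  simp only [setIntegral_chartWeight_eq G x _
    fun p hp => image_eq_zero_of_notMem_tsupport fun h => hp (hkx h)]
  rw [← integral_finsetSum]
  · refine setIntegral_congr_fun (isOpen_extChartAt_target x).measurableSet fun z _ => ?_
    rw [← Finset.mul_sum, ← Finset.sum_mul, ← Complex.ofReal_sum, hs1, Complex.ofReal_one, one_mul]
  · intro y _
    refine integrableOn_chart (isClosed_tsupport k) hkx ?_ fun z _ h => ?_
    · refine (Complex.continuous_ofReal.comp_continuousOn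
        (contDiffOn_volDensity G x).continuousOn).mul (ContinuousOn.mul ?_ ?_)
      · exact Complex.continuous_ofReal.comp_continuousOn (continuousOn_comp_symm_chart
          (partitionOfUnity m S y).contMDiff.continuous.continuousOn)
      · exact continuousOn_comp_symm_chart hk.continuousOn
    · rw [image_eq_zero_of_notMem_tsupport h]
      simp

end Volume

/-! ### Green's formula and the symmetry of the Laplacian. -/

section Green

variable {m : ℕ} {S : Type*} [TopologicalSpace S] [ChartedSpace (EuclideanSpace ℝ (Fin m)) S]

theorem continuous_of_continuousOn_charts {F : Type*} [TopologicalSpace F] {k : S → F}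
    (hk : ∀ x, ContinuousOn (fun z => k ((extChartAt (𝓡 m) x).symm z))
      (extChartAt (𝓡 m) x).target) : Continuous k := by
  rw [continuous_iff_continuousAt]
  intro p
  have h1 : ContinuousOn (fun q => k ((extChartAt (𝓡 m) p).symm (extChartAt (𝓡 m) p q)))
      (extChartAt (𝓡 m) p).source :=
    (hk p).comp (continuousOn_extChartAt p) fun q hq => (extChartAt (𝓡 m) p).map_source hq
  have h2 : ContinuousOn k (extChartAt (𝓡 m) p).source :=
    h1.congr fun q hq => (congrArg k ((extChartAt (𝓡 m) p).left_inv hq)).symm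
  exact h2.continuousAt (extChartAt_source_mem_nhds p)

variable [IsManifold (𝓡 m) ∞ S]

/-- The vector field `√G G^{AB} ∂_B F` in the chart around `x`. -/
noncomputable def chartFlux (G : Metric m S) (x : S) (F : EuclideanSpace ℝ (Fin m) → ℂ) (A : Fin m)
    (w : EuclideanSpace ℝ (Fin m)) : ℂ :=
  ∑ B : Fin m, (volDensity G x w * (metricMatrix G x w)⁻¹ A B) •
    fderiv ℝ F w (EuclideanSpace.single B (1 : ℝ))

theorem contDiffOn_fderiv_comp_symm_chart {f : S → ℂ} (hf : ContMDiff (𝓡 m) 𝓘(ℝ, ℂ) ∞ f) (x : S)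
    (v : EuclideanSpace ℝ (Fin m)) :
    ContDiffOn ℝ ∞ (fun z => fderiv ℝ (f ∘ (extChartAt (𝓡 m) x).symm) z v)
      (extChartAt (𝓡 m) x).target :=
  ((contDiffOn_comp_symm_chart hf x).fderiv_of_isOpen (isOpen_extChartAt_target x)
    (by simp)).clm_apply contDiffOn_const

theorem contDiffOn_chartFlux (G : Metric m S) {f : S → ℂ} (hf : ContMDiff (𝓡 m) 𝓘(ℝ, ℂ) ∞ f)
    (x : S) (A : Fin m) :
    ContDiffOn ℝ ∞ (chartFlux G x (f ∘ (extChartAt (𝓡 m) x).symm) A)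
      (extChartAt (𝓡 m) x).target :=
  ContDiffOn.sum fun B _ => ((contDiffOn_volDensity G x).mul
    (contDiffOn_metricMatrix_inv G x A B)).smul (contDiffOn_fderiv_comp_symm_chart hf x _)

theorem contDiffOn_fderiv_chartFlux (G : Metric m S) {f : S → ℂ}
    (hf : ContMDiff (𝓡 m) 𝓘(ℝ, ℂ) ∞ f) (x : S) (A : Fin m) (v : EuclideanSpace ℝ (Fin m)) :
    ContDiffOn ℝ ∞ (fun z => fderiv ℝ (chartFlux G x (f ∘ (extChartAt (𝓡 m) x).symm) A) z v)
      (extChartAt (𝓡 m) x).target :=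
  ((contDiffOn_chartFlux G hf x A).fderiv_of_isOpen (isOpen_extChartAt_target x)
    (by simp)).clm_apply contDiffOn_const

theorem volDensity_mul_chartLaplacian (G : Metric m S) (x : S)
    (F : EuclideanSpace ℝ (Fin m) → ℂ) {z : EuclideanSpace ℝ (Fin m)}
    (hz : z ∈ (extChartAt (𝓡 m) x).target) :
    (volDensity G x z : ℂ) * chartLaplacian G x F z
      = ∑ A, fderiv ℝ (chartFlux G x F A) z (EuclideanSpace.single A (1 : ℝ)) := by
  have h : volDensity G x z ≠ 0 := (volDensity_pos G x hz).ne'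
  rw [← Complex.real_smul, chartLaplacian, smul_smul, mul_inv_cancel₀ h, one_smul]
  rfl

/-- `HasLaplacian` demands no regularity of `h`; it is inherited from the smoothness of `f` through
the local formula. -/
theorem HasLaplacian.continuous {G : Metric m S} {f h : S → ℂ} (H : HasLaplacian G f h) :
    Continuous h := by
  refine continuous_of_continuousOn_charts (m := m) fun x => ?_
  have h1 : ContinuousOn (fun z => (volDensity G x z)⁻¹ •
      ∑ A, fderiv ℝ (chartFlux G x (f ∘ (extChartAt (𝓡 m) x).symm) A) z
        (EuclideanSpace.single A (1 : ℝ))) (extChartAt (𝓡 m) x).target :=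
    ((contDiffOn_volDensity G x).continuousOn.inv₀ fun z hz => (volDensity_pos G x hz).ne').smul
      (continuousOn_finsetSum _ fun A _ => (contDiffOn_fderiv_chartFlux G H.1 x A _).continuousOn)
  exact h1.congr fun z hz => (H.2 x z hz).symm

theorem continuous_gradPairing (G : Metric m S) {f h : S → ℂ} (hf : ContMDiff (𝓡 m) 𝓘(ℝ, ℂ) ∞ f)
    (hh : ContMDiff (𝓡 m) 𝓘(ℝ, ℂ) ∞ h) : Continuous (gradPairing G f h) := by
  refine continuous_of_continuousOn_charts (m := m) fun x => ?_
  have h1 : ContinuousOn (chartPairing G x (f ∘ (extChartAt (𝓡 m) x).symm)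
      (h ∘ (extChartAt (𝓡 m) x).symm)) (extChartAt (𝓡 m) x).target :=
    continuousOn_finsetSum _ fun A _ => continuousOn_finsetSum _ fun B _ =>
      (Complex.continuous_ofReal.comp_continuousOn
        (contDiffOn_metricMatrix_inv G x A B).continuousOn).mul
        ((contDiffOn_fderiv_comp_symm_chart hf x _).continuousOn.mul
          (contDiffOn_fderiv_comp_symm_chart hh x _).continuousOn)
  exact h1.congr fun z hz => gradPairing_symm_chart G hf hh hz

theorem gradPairing_comm (G : Metric m S) (f h : S → ℂ) (p : S) :
    gradPairing G f h p = gradPairing G h f p := by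
  unfold gradPairing chartPairing
  have hs : (metricMatrix G p (extChartAt (𝓡 m) p p))⁻¹.IsSymm := by
    have := (posDef_metricMatrix G p (mem_extChartAt_target p)).isHermitian.inv
    rwa [Matrix.IsHermitian, Matrix.conjTranspose_eq_transpose_of_trivial] at this
  rw [Finset.sum_comm]
  refine Finset.sum_congr rfl fun A _ => Finset.sum_congr rfl fun B _ => ?_
  rw [hs.apply A B, mul_comm (fderiv ℝ (f ∘ _) _ _)]

theorem gradPairing_conj (G : Metric m S) (f h : S → ℂ) (p : S) :
    gradPairing G (fun q => starRingEnd ℂ (f q)) (fun q => starRingEnd ℂ (h q)) p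
      = starRingEnd ℂ (gradPairing G f h p) := by
  have key : ∀ (F : EuclideanSpace ℝ (Fin m) → ℂ) (z v : EuclideanSpace ℝ (Fin m)),
      fderiv ℝ (fun w => starRingEnd ℂ (F w)) z v = starRingEnd ℂ (fderiv ℝ F z v) := by
    intro F z v
    have := ContinuousLinearEquiv.comp_fderiv (𝕜 := ℝ) Complex.conjCLE (f := F) (x := z)
    exact congrArg (fun L : EuclideanSpace ℝ (Fin m) →L[ℝ] ℂ => L v) this
  unfold gradPairing chartPairing
  simp only [map_sum, map_mul, Complex.conj_ofReal, ← key]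
  rfl

theorem fderiv_comp_symm_chart_eq_zero {f : S → ℂ} {x : S} {z : EuclideanSpace ℝ (Fin m)}
    (hz : z ∈ (extChartAt (𝓡 m) x).target) (hf : (extChartAt (𝓡 m) x).symm z ∉ tsupport f) :
    fderiv ℝ (f ∘ (extChartAt (𝓡 m) x).symm) z = 0 := by
  have h1 : f ∘ (extChartAt (𝓡 m) x).symm =ᶠ[𝓝 z] fun _ => (0 : ℂ) :=
    (mdifferentiableAt_symm_chart hz).continuousAt.eventually
      (notMem_tsupport_iff_eventuallyEq.1 hf)
  rw [h1.fderiv_eq, fderiv_fun_const, Pi.zero_apply]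

theorem gradPairing_eq_zero_of_notMem_tsupport (G : Metric m S) {f : S → ℂ} (h : S → ℂ) {p : S}
    (hp : p ∉ tsupport f) : gradPairing G f h p = 0 := by
  have h1 := fderiv_comp_symm_chart_eq_zero (m := m) (f := f) (mem_extChartAt_target p)
    (by rwa [extChartAt_to_inv])
  unfold gradPairing chartPairing
  simp only [h1, zero_apply, zero_mul, mul_zero, Finset.sum_const_zero]

theorem tsupport_gradPairing_subset (G : Metric m S) (f h : S → ℂ) :
    tsupport (gradPairing G f h) ⊆ tsupport f := by
  refine closure_minimal (fun p hp => ?_) (isClosed_tsupport f)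
  by_contra hp'
  exact hp (gradPairing_eq_zero_of_notMem_tsupport G h hp')

theorem gradPairing_sum (G : Metric m S) {ι : Type*} (s : Finset ι) {f : ι → S → ℂ}
    (hf : ∀ i ∈ s, ContMDiff (𝓡 m) 𝓘(ℝ, ℂ) ∞ (f i)) (h : S → ℂ) (p : S) :
    gradPairing G (fun q => ∑ i ∈ s, f i q) h p = ∑ i ∈ s, gradPairing G (f i) h p := by
  have key : fderiv ℝ ((fun q => ∑ i ∈ s, f i q) ∘ (extChartAt (𝓡 m) p).symm)
      (extChartAt (𝓡 m) p p)
      = ∑ i ∈ s, fderiv ℝ (f i ∘ (extChartAt (𝓡 m) p).symm) (extChartAt (𝓡 m) p p) :=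
    fderiv_fun_sum fun i hi => differentiableAt_comp_symm_chart (hf i hi) (mem_extChartAt_target p)
  unfold gradPairing chartPairing
  simp only [key, FunLike.coe_sum, Finset.sum_apply, Finset.sum_mul, Finset.mul_sum]
  exact (Finset.sum_congr rfl fun A _ => Finset.sum_comm).trans Finset.sum_comm

variable [CompactSpace S]

/-- Integration by parts in one chart. The support of `k` is compact inside the chart, so no
boundary term appears. -/
theorem setIntegral_mul_divergence (G : Metric m S) {f k : S → ℂ} {x : S}
    (hf : ContMDiff (𝓡 m) 𝓘(ℝ, ℂ) ∞ f) (hk : ContMDiff (𝓡 m) 𝓘(ℝ, ℂ) ∞ k)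
    (hkx : tsupport k ⊆ (extChartAt (𝓡 m) x).source) (A : Fin m) :
    ∫ z in (extChartAt (𝓡 m) x).target, k ((extChartAt (𝓡 m) x).symm z) *
        fderiv ℝ (chartFlux G x (f ∘ (extChartAt (𝓡 m) x).symm) A) z
          (EuclideanSpace.single A (1 : ℝ))
      = -∫ z in (extChartAt (𝓡 m) x).target,
        fderiv ℝ (k ∘ (extChartAt (𝓡 m) x).symm) z (EuclideanSpace.single A (1 : ℝ)) *
          chartFlux G x (f ∘ (extChartAt (𝓡 m) x).symm) A z := by
  set U := (extChartAt (𝓡 m) x).target with hU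
  set W := chartFlux G x (f ∘ (extChartAt (𝓡 m) x).symm) A
  set e : EuclideanSpace ℝ (Fin m) := EuclideanSpace.single A (1 : ℝ)
  have hUo : IsOpen U := isOpen_extChartAt_target x
  set C := extChartAt (𝓡 m) x '' tsupport k
  have hCc : IsCompact C := isCompact_image_chart (isClosed_tsupport k) hkx
  have hCU : C ⊆ U := image_chart_subset_target hkx
  have hk0 : ∀ z ∈ U, z ∉ C → k ((extChartAt (𝓡 m) x).symm z) = 0 := fun z hz hzC =>
    image_eq_zero_of_notMem_tsupport (symm_chart_notMem hz hzC)
  -- Extension of `k` by zero to the whole coordinate space; it is differentiable everywhere. The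
  -- flux `W` is controlled only on `U`, which is enough because `K` is supported in `C ⊆ U`.
  set K : EuclideanSpace ℝ (Fin m) → ℂ := U.indicator (k ∘ (extChartAt (𝓡 m) x).symm) with hK
  have hKU : ∀ z ∈ U, K z = k ((extChartAt (𝓡 m) x).symm z) := fun z hz => indicator_of_mem hz _
  have hKeq : ∀ z ∈ U, K =ᶠ[𝓝 z] k ∘ (extChartAt (𝓡 m) x).symm := fun z hz => by
    filter_upwards [hUo.mem_nhds hz] with w hw using hKU w hw
  have hKC : ∀ z ∉ C, K z = 0 := by
    intro z hz
    by_cases hzU : z ∈ U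
    · rw [hKU z hzU, hk0 z hzU hz]
    · exact indicator_of_notMem hzU _
  have hKC' : ∀ z ∉ C, K =ᶠ[𝓝 z] fun _ => 0 := fun z hz => by
    filter_upwards [hCc.isClosed.isOpen_compl.mem_nhds hz] with w hw using hKC w hw
  have hKts : tsupport K ⊆ C := closure_minimal (fun z hz => by
    by_contra h
    exact hz (hKC z h)) hCc.isClosed
  have hKd : ∀ z, DifferentiableAt ℝ K z := by
    intro z
    by_cases hz : z ∈ U
    · exact ((hKeq z hz).differentiableAt_iff).2 (differentiableAt_comp_symm_chart hk hz)
    · exact ((hKC' z fun h => hz (hCU h)).differentiableAt_iff).2 (differentiableAt_const _)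
  have hKf : ∀ z ∉ C, fderiv ℝ K z = 0 := fun z hz => by
    rw [(hKC' z hz).fderiv_eq]
    simp
  have hWd : ∀ z ∈ U, DifferentiableAt ℝ W z := fun z hz =>
    ((contDiffOn_chartFlux G hf x A).contDiffAt (hUo.mem_nhds hz)).differentiableAt (by simp)
  have hint : ∀ g : EuclideanSpace ℝ (Fin m) → ℂ, ContinuousOn g U → (∀ z ∉ C, g z = 0) →
      Integrable g := by
    intro g hg hg0
    rw [← integrableOn_iff_integrable_of_support_subset (s := C)
      fun z hz => by_contra fun h => hz (hg0 z h)]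
    exact (hg.mono hCU).integrableOn_compact hCc
  have hKc : Continuous K := continuous_iff_continuousAt.2 fun z => (hKd z).continuousAt
  have hWc : ContinuousOn W U := (contDiffOn_chartFlux G hf x A).continuousOn
  have hW'c : ContinuousOn (fun z => fderiv ℝ W z e) U :=
    (contDiffOn_fderiv_chartFlux G hf x A e).continuousOn
  have hK'c : ContinuousOn (fun z => fderiv ℝ K z e) U :=
    (contDiffOn_fderiv_comp_symm_chart hk x e).continuousOn.congr fun z hz => by
      rw [(hKeq z hz).fderiv_eq]
  have hparts := integral_mul_fderiv_eq_neg_fderiv_mul_of_integrable (μ := volume) (𝕜 := ℂ)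
    (f := K) (g := W) (v := e)
    (hint _ (hK'c.mul hWc) fun z hz => by rw [hKf z hz]; simp)
    (hint _ (hKc.continuousOn.mul hW'c) fun z hz => by rw [hKC z hz, zero_mul])
    (hint _ (hKc.continuousOn.mul hWc) fun z hz => by rw [hKC z hz, zero_mul])
    (fun z _ => hKd z) (fun z hz => hWd z (hCU (hKts hz)))
  have h1 : ∫ z in U, k ((extChartAt (𝓡 m) x).symm z) * fderiv ℝ W z e
      = ∫ z, K z * fderiv ℝ W z e := by
    rw [setIntegral_congr_fun (g := fun z => K z * fderiv ℝ W z e) hUo.measurableSet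
      fun z hz => by simp only [hKU z hz]]
    exact setIntegral_eq_integral_of_forall_compl_eq_zero
      fun z hz => by rw [hKC z fun h => hz (hCU h), zero_mul]
  have h2 : ∫ z in U, fderiv ℝ (k ∘ (extChartAt (𝓡 m) x).symm) z e * W z
      = ∫ z, fderiv ℝ K z e * W z := by
    rw [setIntegral_congr_fun (g := fun z => fderiv ℝ K z e * W z) hUo.measurableSet
      fun z hz => by simp only [(hKeq z hz).fderiv_eq]]
    exact setIntegral_eq_integral_of_forall_compl_eq_zero
      fun z hz => by rw [hKf z fun h => hz (hCU h)]; simp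
  rw [h1, h2, hparts]

variable [T2Space S] [MeasurableSpace S] [BorelSpace S]

theorem integral_mul_laplacian_of_tsupport_subset {G : Metric m S} {f h k : S → ℂ} {x : S}
    (H : HasLaplacian G f h) (hk : ContMDiff (𝓡 m) 𝓘(ℝ, ℂ) ∞ k)
    (hkx : tsupport k ⊆ (extChartAt (𝓡 m) x).source) :
    ∫ p, k p * h p ∂riemannianVolume G = -∫ p, gradPairing G k f p ∂riemannianVolume G := by
  have hU := (isOpen_extChartAt_target (I := 𝓡 m) x).measurableSet
  have hkc := continuousOn_comp_symm_chart (m := m) (x := x) hk.continuous.continuousOn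
  rw [integral_eq_setIntegral_chart G (x := x) (k := fun p => k p * h p)
      (hk.continuous.mul H.continuous) (tsupport_mul_subset_left.trans hkx),
    integral_eq_setIntegral_chart G (x := x) (continuous_gradPairing G hk H.1)
      ((tsupport_gradPairing_subset G k f).trans hkx)]
  have h1 : ∫ z in (extChartAt (𝓡 m) x).target, (volDensity G x z : ℂ) *
        (k ((extChartAt (𝓡 m) x).symm z) * h ((extChartAt (𝓡 m) x).symm z))
      = ∫ z in (extChartAt (𝓡 m) x).target, ∑ A, k ((extChartAt (𝓡 m) x).symm z) *
        fderiv ℝ (chartFlux G x (f ∘ (extChartAt (𝓡 m) x).symm) A) z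
          (EuclideanSpace.single A (1 : ℝ)) :=
    setIntegral_congr_fun hU fun z hz => by
      rw [← Finset.mul_sum, ← volDensity_mul_chartLaplacian G x _ hz, H.2 x z hz]
      ring
  have h2 : ∫ z in (extChartAt (𝓡 m) x).target, (volDensity G x z : ℂ) *
        gradPairing G k f ((extChartAt (𝓡 m) x).symm z)
      = ∫ z in (extChartAt (𝓡 m) x).target, ∑ A,
        fderiv ℝ (k ∘ (extChartAt (𝓡 m) x).symm) z (EuclideanSpace.single A (1 : ℝ)) *
          chartFlux G x (f ∘ (extChartAt (𝓡 m) x).symm) A z :=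
    setIntegral_congr_fun hU fun z hz => by
      simp only [gradPairing_symm_chart G hk H.1 hz, chartPairing, chartFlux, Finset.mul_sum,
        Complex.real_smul, Complex.ofReal_mul]
      exact Finset.sum_congr rfl fun A _ => Finset.sum_congr rfl fun B _ => by ring
  rw [h1, h2, integral_finsetSum, integral_finsetSum, ← Finset.sum_neg_distrib]
  · exact Finset.sum_congr rfl fun A _ => setIntegral_mul_divergence G H.1 hk hkx A
  · intro A _
    refine integrableOn_chart (isClosed_tsupport k) hkx
      ((contDiffOn_fderiv_comp_symm_chart hk x _).continuousOn.mul
        (contDiffOn_chartFlux G H.1 x A).continuousOn) fun z hz hzk => ?_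
    rw [fderiv_comp_symm_chart_eq_zero hz hzk, zero_apply, zero_mul]
  · intro A _
    refine integrableOn_chart (isClosed_tsupport k) hkx
      (hkc.mul (contDiffOn_fderiv_chartFlux G H.1 x A _).continuousOn) fun z _ hz => ?_
    rw [image_eq_zero_of_notMem_tsupport hz, zero_mul]

/-- Green's formula. -/
theorem integral_mul_laplacian {G : Metric m S} {f h k : S → ℂ}
    (H : HasLaplacian G f h) (hk : ContMDiff (𝓡 m) 𝓘(ℝ, ℂ) ∞ k) :
    ∫ p, k p * h p ∂riemannianVolume G = -∫ p, gradPairing G k f p ∂riemannianVolume G := by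
  have := isFiniteMeasure_riemannianVolume G
  obtain ⟨s, -, hs⟩ := exists_finset_partitionOfUnity m S
  -- Only the factor `k` is localized: `f` stays intact, so `HasLaplacian` need not be checked for
  -- products.
  set κ : S → S → ℂ := fun x p => partitionOfUnity m S x p • k p with hκ
  have hκs : ∀ x, ContMDiff (𝓡 m) 𝓘(ℝ, ℂ) ∞ (κ x) := fun x =>
    (partitionOfUnity m S x).contMDiff.smul hk
  have hκx : ∀ x, tsupport (κ x) ⊆ (extChartAt (𝓡 m) x).source := fun x =>
    (tsupport_smul_subset_left _ _).trans (tsupport_partitionOfUnity_subset x)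
  have hsum : k = fun p => ∑ x ∈ s, κ x p := by
    ext p
    simp only [hκ]
    rw [← Finset.sum_smul, hs, one_smul]
  have h1 : ∀ p, k p * h p = ∑ x ∈ s, κ x p * h p := fun p => by
    rw [← Finset.sum_mul, ← congrFun hsum p]
  have h2 : ∀ p, gradPairing G k f p = ∑ x ∈ s, gradPairing G (κ x) f p := fun p => by
    rw [← gradPairing_sum G s fun x _ => hκs x, ← hsum]
  simp only [h1, h2]
  rw [integral_finsetSum s (f := fun x p => κ x p * h p) fun x _ =>
      Continuous.integrable_of_isFiniteMeasure ((hκs x).continuous.mul H.continuous),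
    integral_finsetSum _ fun x _ => Continuous.integrable_of_isFiniteMeasure
      (continuous_gradPairing G (hκs x) H.1), ← Finset.sum_neg_distrib]
  exact Finset.sum_congr rfl fun x _ =>
    integral_mul_laplacian_of_tsupport_subset H (hκs x) (hκx x)

/-- The Laplace operator is symmetric. -/
theorem inner_laplacian {G : Metric m S} {K F K' F' : L2Matter G} (h : IsLaplacianOf G K F)
    (h' : IsLaplacianOf G K' F') : ⟪K, F'⟫_ℂ = ⟪F, K'⟫_ℂ := by
  obtain ⟨f, l, H, hF, hK⟩ := h
  obtain ⟨f', l', H', hF', hK'⟩ := h'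
  have hconj : ∀ {g : S → ℂ}, ContMDiff (𝓡 m) 𝓘(ℝ, ℂ) ∞ g →
      ContMDiff (𝓡 m) 𝓘(ℝ, ℂ) ∞ fun p => starRingEnd ℂ (g p) := fun hg =>
    (Complex.conjCLE.contDiff.contMDiff).comp hg
  have h1 : ⟪K, F'⟫_ℂ = starRingEnd ℂ (∫ p, starRingEnd ℂ (f' p) * l p ∂riemannianVolume G) := by
    rw [L2.inner_def, ← integral_conj]
    refine integral_congr_ae ?_
    filter_upwards [hK, hF'] with p hp1 hp2
    rw [hp1, hp2, RCLike.inner_apply, map_mul, Complex.conj_conj]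
  have h2 : ⟪F, K'⟫_ℂ = ∫ p, starRingEnd ℂ (f p) * l' p ∂riemannianVolume G := by
    rw [L2.inner_def]
    refine integral_congr_ae ?_
    filter_upwards [hF, hK'] with p hp1 hp2
    rw [hp1, hp2, RCLike.inner_apply, mul_comm]
  -- Both sides become minus the integral of the pairing of `f'` with the conjugate of `f`. The
  -- pairing is bilinear with real symmetric coefficients, so it commutes with conjugation and with
  -- exchange of its arguments.
  rw [h1, h2, integral_mul_laplacian H (hconj H'.1), integral_mul_laplacian H' (hconj H.1),
    map_neg, ← integral_conj]
  congr 1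
  refine integral_congr_ae (Eventually.of_forall fun p => ?_)
  have := gradPairing_conj G (fun q => starRingEnd ℂ (f' q)) f p
  simp only [Complex.conj_conj] at this
  dsimp only
  rw [← this, gradPairing_comm]

end Green

/-! ### Operators given on a spanning family. -/

section Span

variable {E : Type*} [NormedAddCommGroup E] [InnerProductSpace ℂ E]

/-- A sesquilinear identity between families of vectors extends to linear combinations. -/
theorem inner_linearCombination_eq {ι : Type*} {a b d₁ d₂ d₃ : ι → E} {c : ℝ}
    (h : ∀ i j, ⟪b i, a j⟫_ℂ = c * ⟪a i, a j⟫_ℂ - ⟪d₁ i, d₁ j⟫_ℂ - ⟪d₂ i, d₂ j⟫_ℂ - ⟪d₃ i, d₃ j⟫_ℂ)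
    (x y : ι →₀ ℂ) :
    ⟪Finsupp.linearCombination ℂ b x, Finsupp.linearCombination ℂ a y⟫_ℂ
      = c * ⟪Finsupp.linearCombination ℂ a x, Finsupp.linearCombination ℂ a y⟫_ℂ
        - ⟪Finsupp.linearCombination ℂ d₁ x, Finsupp.linearCombination ℂ d₁ y⟫_ℂ
        - ⟪Finsupp.linearCombination ℂ d₂ x, Finsupp.linearCombination ℂ d₂ y⟫_ℂ
        - ⟪Finsupp.linearCombination ℂ d₃ x, Finsupp.linearCombination ℂ d₃ y⟫_ℂ := by
  induction x using Finsupp.induction_linear with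
  | zero => simp
  | add x x' hx hx' =>
    simp only [map_add, inner_add_left, hx, hx']
    ring
  | single i s =>
    induction y using Finsupp.induction_linear with
    | zero => simp
    | add y y' hy hy' =>
      simp only [map_add, inner_add_right, hy, hy']
      ring
    | single j t =>
      simp only [Finsupp.linearCombination_single, inner_smul_left, inner_smul_right, h]
      ring

/-- On linear combinations the form is `c` times the inner product minus three Gram forms: Hermitian
because `c` is real, and at most `c‖·‖²` because Gram forms are nonnegative. -/
theorem isSelfAdjointInFriedrichsSense_span [CompleteSpace E] {ι : Type*} {a b d₁ d₂ d₃ : ι → E}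
    {c : ℝ}
    (h : ∀ i j, ⟪b i, a j⟫_ℂ = c * ⟪a i, a j⟫_ℂ - ⟪d₁ i, d₁ j⟫_ℂ - ⟪d₂ i, d₂ j⟫_ℂ - ⟪d₃ i, d₃ j⟫_ℂ)
    (hd : Dense (Submodule.span ℂ (range a) : Set E)) :
    IsSelfAdjointInFriedrichsSense (Submodule.span ℂ (range fun i => (a i, b i))) := by
  have hmem : ∀ p ∈ Submodule.span ℂ (range fun i => (a i, b i)), ∃ x : ι →₀ ℂ,
      p = (Finsupp.linearCombination ℂ a x, Finsupp.linearCombination ℂ b x) := by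
    intro p hp
    obtain ⟨x, rfl⟩ := Finsupp.mem_span_range_iff_exists_finsupp.1 hp
    refine ⟨x, ?_⟩
    simp only [Finsupp.linearCombination_apply, Finsupp.sum]
    ext
    · simp [Prod.fst_sum]
    · simp [Prod.snd_sum]
  have hkey := inner_linearCombination_eq h
  refine isSelfAdjointInFriedrichsSense (hd.mono ?_) ?_ ⟨c, ?_⟩
  · have : Submodule.span ℂ (range a)
        = (Submodule.span ℂ (range fun i => (a i, b i))).map (LinearMap.fst ℂ E E) := by
      rw [Submodule.map_span, ← range_comp]
      rfl
    rw [this]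
    exact fun x hx => hx
  · intro p hp q hq
    obtain ⟨x, rfl⟩ := hmem p hp
    obtain ⟨y, rfl⟩ := hmem q hq
    rw [← inner_conj_symm (Finsupp.linearCombination ℂ a x), hkey x y, hkey y x]
    simp only [map_sub, map_mul, Complex.conj_ofReal, inner_conj_symm]
  · intro p hp
    obtain ⟨x, rfl⟩ := hmem p hp
    have hre : ∀ v : E, (⟪v, v⟫_ℂ).re = ‖v‖ ^ 2 := fun v => (norm_sq_eq_re_inner (𝕜 := ℂ) v).symm
    rw [hkey x x]
    simp only [Complex.sub_re, Complex.re_ofReal_mul, hre]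
    nlinarith [sq_nonneg ‖Finsupp.linearCombination ℂ d₁ x‖,
      sq_nonneg ‖Finsupp.linearCombination ℂ d₂ x‖, sq_nonneg ‖Finsupp.linearCombination ℂ d₃ x‖]

end Span

/-! ### Pure tensors in the Hilbert space tensor product. -/

section TensorProduct

variable {X Y : Type*} [NormedAddCommGroup X] [InnerProductSpace ℂ X] [NormedAddCommGroup Y]
  [InnerProductSpace ℂ Y]

/-- `y ↦ x ⊗ y` as a map to the Hilbert space tensor product. -/
noncomputable def pureTensor (Y : Type*) [NormedAddCommGroup Y] [InnerProductSpace ℂ Y] (x : X) :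
    Y →ₗ[ℂ] UniformSpace.Completion (X ⊗[ℂ] Y) :=
  (UniformSpace.Completion.toComplₗᵢ (𝕜 := ℂ)).toLinearMap ∘ₗ TensorProduct.mk ℂ X Y x

theorem inner_pureTensor (x x' : X) (y y' : Y) :
    ⟪pureTensor Y x y, pureTensor Y x' y'⟫_ℂ = ⟪x, x'⟫_ℂ * ⟪y, y'⟫_ℂ :=
  (UniformSpace.Completion.inner_coe _ _).trans (TensorProduct.inner_tmul ..)

theorem continuous_pureTensor_left (y : Y) : Continuous fun x : X => pureTensor Y x y :=
  (UniformSpace.Completion.continuous_coe _).comp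
    (TensorProduct.continuous_tmul.comp (by fun_prop : Continuous fun x : X => (x, y)))

/-- The second factor is reached by linearity alone, as `s` spans `Y` algebraically; the first by
continuity of `x ↦ x ⊗ y`. -/
theorem dense_of_pureTensor_mem {ι : Type*} {j : ι → X} (hj : DenseRange j) {s : Set Y}
    (hs : Submodule.span ℂ s = ⊤) {W : Submodule ℂ (UniformSpace.Completion (X ⊗[ℂ] Y))}
    (hW : ∀ i, ∀ y ∈ s, pureTensor Y (j i) y ∈ W) :
    Dense (W : Set (UniformSpace.Completion (X ⊗[ℂ] Y))) := by
  have h1 : ∀ i y, pureTensor Y (j i) y ∈ W := by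
    intro i y
    have : (⊤ : Submodule ℂ Y) ≤ W.comap (pureTensor Y (j i)) := by
      rw [← hs, Submodule.span_le]
      exact hW i
    exact this trivial
  have h2 : ∀ x y, pureTensor Y x y ∈ W.topologicalClosure := by
    intro x y
    refine hj.induction_on (p := fun x => pureTensor Y x y ∈ W.topologicalClosure) x ?_ fun i =>
      W.le_topologicalClosure (h1 i y)
    exact W.isClosed_topologicalClosure.preimage (continuous_pureTensor_left y)
  have h3 : ∀ t : X ⊗[ℂ] Y,
      (t : UniformSpace.Completion (X ⊗[ℂ] Y)) ∈ W.topologicalClosure := by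
    intro t
    induction t with
    | zero => exact W.topologicalClosure.zero_mem
    | tmul x y => exact h2 x y
    | add s t hs ht =>
      rw [UniformSpace.Completion.coe_add]
      exact W.topologicalClosure.add_mem hs ht
  rw [Submodule.dense_iff_topologicalClosure_eq_top, Submodule.eq_top_iff']
  intro x
  induction x using UniformSpace.Completion.induction_on with
  | hp => exact W.isClosed_topologicalClosure
  | ih t => exact h3 t

end TensorProduct

/-! ### Symmetric relations with spanning eigenvectors. -/

section Eigenvectors

variable {Y : Type*} [NormedAddCommGroup Y] [InnerProductSpace ℂ Y] {L : Y → Y → Prop}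

theorem mul_inner_eq_of_symmetric
    (hL : ∀ {K F K' F' : Y}, L K F → L K' F' → ⟪K, F'⟫_ℂ = ⟪F, K'⟫_ℂ) {F F' : Y} {μ μ' : ℝ}
    (h : L (-(μ : ℂ) • F) F) (h' : L (-(μ' : ℂ) • F') F') :
    (μ : ℂ) * ⟪F, F'⟫_ℂ = μ' * ⟪F, F'⟫_ℂ := by
  have h1 := hL h h'
  rw [inner_smul_left, inner_smul_right, map_neg, Complex.conj_ofReal] at h1
  linear_combination -h1

/-- Eigenvectors for different eigenvalues are orthogonal, so either both sides vanish or `μ = μ'`.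
This rewrites a coefficient depending on one eigenvalue as a product of one factor per vector, as a
Gram form requires. -/
theorem sqrt_mul_sqrt_mul_inner
    (hL : ∀ {K F K' F' : Y}, L K F → L K' F' → ⟪K, F'⟫_ℂ = ⟪F, K'⟫_ℂ) {F F' : Y} {μ μ' : ℝ}
    (h : L (-(μ : ℂ) • F) F) (h' : L (-(μ' : ℂ) • F') F') {g : ℝ → ℝ} (hg : g μ ≤ 0) :
    (√(-g μ) : ℂ) * √(-g μ') * ⟪F, F'⟫_ℂ = -(g μ) * ⟪F, F'⟫_ℂ := by
  have h1 := mul_inner_eq_of_symmetric hL h h'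
  by_cases h0 : ⟪F, F'⟫_ℂ = 0
  · rw [h0, mul_zero, mul_zero]
  · have h2 : μ = μ' := by exact_mod_cast mul_right_cancel₀ h0 h1
    rw [← h2, ← Complex.ofReal_mul, Real.mul_self_sqrt (by linarith), Complex.ofReal_neg]

/-- A symmetric relation on a space spanned by eigenvectors is the linear extension of its values
on the eigenvectors. -/
theorem mem_span_eigenvectors
    (hL : ∀ {K F K' F' : Y}, L K F → L K' F' → ⟪K, F'⟫_ℂ = ⟪F, K'⟫_ℂ) {p : ℝ → Prop}
    (hs : Submodule.span ℂ {F : Y | ∃ μ : ℝ, p μ ∧ L (-(μ : ℂ) • F) F} = ⊤) {F K : Y} (h : L K F) :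
    (F, K) ∈ Submodule.span ℂ {q : Y × Y |
      ∃ μ : ℝ, p μ ∧ L (-(μ : ℂ) • q.1) q.1 ∧ q.2 = -(μ : ℂ) • q.1} := by
  set D := Submodule.span ℂ {q : Y × Y |
      ∃ μ : ℝ, p μ ∧ L (-(μ : ℂ) • q.1) q.1 ∧ q.2 = -(μ : ℂ) • q.1} with hD
  have hex : F ∈ D.map (LinearMap.fst ℂ _ _) := by
    have : (⊤ : Submodule ℂ Y) ≤ D.map (LinearMap.fst ℂ _ _) := by
      rw [← hs, Submodule.span_le]
      rintro F ⟨μ, hμ, hF⟩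
      exact ⟨(F, -(μ : ℂ) • F), Submodule.subset_span ⟨μ, hμ, hF, rfl⟩, rfl⟩
    exact this trivial
  -- `K'` is the value at the same vector obtained by linear extension from eigenvectors. Symmetry
  -- makes `K - K'` orthogonal to every eigenvector, hence to all of `Y`; linearity of `L` is not
  -- needed.
  obtain ⟨⟨F', K'⟩, hFK, rfl⟩ := hex
  have hsym : ∀ (F₁ : Y) (μ : ℝ), L (-(μ : ℂ) • F₁) F₁ → ⟪F₁, K'⟫_ℂ = ⟪-(μ : ℂ) • F₁, F'⟫_ℂ := by
    intro F₁ μ h₁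
    have hle : D ≤ LinearMap.ker ((innerₛₗ ℂ F₁) ∘ₗ LinearMap.snd ℂ _ _
        - (innerₛₗ ℂ (-(μ : ℂ) • F₁)) ∘ₗ LinearMap.fst ℂ _ _) := by
      rw [hD, Submodule.span_le]
      rintro ⟨F₂, K₂⟩ ⟨ν, -, h₂, hK₂⟩
      change ⟪F₁, K₂⟫_ℂ - ⟪-(μ : ℂ) • F₁, F₂⟫_ℂ = 0
      rw [show K₂ = -(ν : ℂ) • F₂ from hK₂, sub_eq_zero]
      exact (hL h₁ h₂).symm
    exact sub_eq_zero.1 (hle hFK)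
  have hz : (⊤ : Submodule ℂ Y) ≤ LinearMap.ker (innerₛₗ ℂ (K - K')) := by
    rw [← hs, Submodule.span_le]
    rintro F₁ ⟨μ, -, h₁⟩
    have h2 : ⟪K, F₁⟫_ℂ = ⟪F', -(μ : ℂ) • F₁⟫_ℂ := hL h h₁
    change ⟪K - K', F₁⟫_ℂ = 0
    rw [inner_sub_left, h2, ← inner_conj_symm K', hsym F₁ μ h₁, inner_conj_symm, sub_self]
  have hzero : ⟪K - K', K - K'⟫_ℂ = 0 := hz trivial
  rw [sub_eq_zero.1 (inner_self_eq_zero.1 hzero)]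
  exact hFK

end Eigenvectors

/-! ### Separation of variables. -/

section SeparatedOperator

variable {X Y ι : Type*} [NormedAddCommGroup X] [InnerProductSpace ℂ X] [NormedAddCommGroup Y]
  [InnerProductSpace ℂ Y]

/-- `(F, K) ↦ k ⊗ F + w ⊗ (-a K - b F) + A v ⊗ F - B z ⊗ F`. -/
noncomputable def separatedMap (Y : Type*) [NormedAddCommGroup Y] [InnerProductSpace ℂ Y]
    (k w v z : X) (a b A B : ℂ) : Y × Y →ₗ[ℂ] UniformSpace.Completion (X ⊗[ℂ] Y) :=
  pureTensor Y k ∘ₗ LinearMap.fst ℂ Y Y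
    + pureTensor Y w ∘ₗ (-(a • LinearMap.snd ℂ Y Y) - b • LinearMap.fst ℂ Y Y)
    + A • pureTensor Y v ∘ₗ LinearMap.fst ℂ Y Y - B • pureTensor Y z ∘ₗ LinearMap.fst ℂ Y Y

theorem separatedMap_apply (k w v z : X) (a b A B : ℂ) (F K : Y) :
    separatedMap Y k w v z a b A B (F, K) = pureTensor Y k F
      + pureTensor Y w (-(a • K) - b • F) + A • pureTensor Y v F - B • pureTensor Y z F := rfl

theorem inner_separatedMap_eigenvector (k w v z x : X) (a b A B μ : ℝ) (F F' : Y) :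
    ⟪separatedMap Y k w v z a b A B (F, -(μ : ℂ) • F), pureTensor Y x F'⟫_ℂ
      = (⟪k, x⟫_ℂ + ((a * μ - b : ℝ) : ℂ) * ⟪w, x⟫_ℂ + A * ⟪v, x⟫_ℂ - B * ⟪z, x⟫_ℂ)
        * ⟪F, F'⟫_ℂ := by
  have h : -((a : ℂ) • (-(μ : ℂ) • F)) - (b : ℂ) • F = ((a * μ - b : ℝ) : ℂ) • F := by
    rw [smul_smul, ← neg_smul, ← sub_smul]
    congr 1
    push_cast
    ring
  rw [separatedMap_apply, h, map_smul]
  simp only [inner_add_left, inner_sub_left, inner_smul_left, inner_pureTensor,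
    Complex.conj_ofReal]
  ring

/-- Selfadjointness of an operator that separates variables into a radial part and a symmetric
operator with a spanning set of eigenvectors. -/
theorem isSelfAdjointInFriedrichsSense_separated {L : Y → Y → Prop}
    (hL : ∀ {K F K' F' : Y}, L K F → L K' F' → ⟪K, F'⟫_ℂ = ⟪F, K'⟫_ℂ) {a b A B c : ℝ}
    (hs : Submodule.span ℂ {F : Y | ∃ μ : ℝ, a * μ - b ≤ 0 ∧ L (-(μ : ℂ) • F) F} = ⊤)
    {j k w v z d e f : ι → X} (hj : DenseRange j)
    (hk : ∀ s t, ⟪k s, j t⟫_ℂ = -⟪d s, d t⟫_ℂ) (hw : ∀ s t, ⟪w s, j t⟫_ℂ = ⟪e s, e t⟫_ℂ)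
    (hf : ∀ s t, (A : ℂ) * ⟪v s, j t⟫_ℂ - B * ⟪z s, j t⟫_ℂ = c * ⟪j s, j t⟫_ℂ - ⟪f s, f t⟫_ℂ) :
    IsSelfAdjointInFriedrichsSense (Submodule.span ℂ
      {p : UniformSpace.Completion (X ⊗[ℂ] Y) × UniformSpace.Completion (X ⊗[ℂ] Y) |
        ∃ (s : ι) (F K : Y), L K F ∧ p.1 = pureTensor Y (j s) F ∧
          p.2 = separatedMap Y (k s) (w s) (v s) (z s) a b A B (F, K)}) := by
  -- Indices are triples of a radial index, an eigenvector and its eigenvalue; the eigenvalue is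
  -- kept as data because it enters `d₂`.
  let κ := {t : ι × Y × ℝ // a * t.2.2 - b ≤ 0 ∧ L (-(t.2.2 : ℂ) • t.2.1) t.2.1}
  have hgraph : Submodule.span ℂ
      {p : UniformSpace.Completion (X ⊗[ℂ] Y) × UniformSpace.Completion (X ⊗[ℂ] Y) |
        ∃ (s : ι) (F K : Y), L K F ∧ p.1 = pureTensor Y (j s) F ∧
          p.2 = separatedMap Y (k s) (w s) (v s) (z s) a b A B (F, K)}
      = Submodule.span ℂ (range fun t : κ => (pureTensor Y (j t.1.1) t.1.2.1,
          separatedMap Y (k t.1.1) (w t.1.1) (v t.1.1) (z t.1.1) a b A B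
            (t.1.2.1, -(t.1.2.2 : ℂ) • t.1.2.1))) := by
    refine le_antisymm (Submodule.span_le.2 ?_) (Submodule.span_le.2 ?_)
    · rintro ⟨p, q⟩ ⟨s, F, K, hFK, h1, h2⟩
      have hle : Submodule.span ℂ {q : Y × Y |
          ∃ μ : ℝ, a * μ - b ≤ 0 ∧ L (-(μ : ℂ) • q.1) q.1 ∧ q.2 = -(μ : ℂ) • q.1} ≤
          (Submodule.span ℂ (range fun t : κ => (pureTensor Y (j t.1.1) t.1.2.1,
            separatedMap Y (k t.1.1) (w t.1.1) (v t.1.1) (z t.1.1) a b A B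
              (t.1.2.1, -(t.1.2.2 : ℂ) • t.1.2.1)))).comap
          ((pureTensor Y (j s) ∘ₗ LinearMap.fst ℂ _ _).prod
            (separatedMap Y (k s) (w s) (v s) (z s) a b A B)) := by
        rw [Submodule.span_le]
        rintro ⟨F, K⟩ ⟨μ, hμ, hF, hK⟩
        refine Submodule.subset_span ⟨⟨(s, F, μ), hμ, hF⟩, ?_⟩
        rw [show K = -(μ : ℂ) • F from hK]
        rfl
      have := hle (mem_span_eigenvectors hL hs hFK)
      rw [show p = _ from h1, show q = _ from h2]
      exact this
    · rintro _ ⟨⟨⟨s, F, μ⟩, hμ, hF⟩, rfl⟩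
      exact Submodule.subset_span ⟨s, F, -(μ : ℂ) • F, hF, rfl, rfl⟩
  rw [hgraph]
  -- `d₁` carries the kinetic term, `d₂` the `r⁻²` term with the root of `-μ̄`, and `d₃` the
  -- difference between `c` and the potential.
  refine isSelfAdjointInFriedrichsSense_span (c := c)
    (d₁ := fun t => pureTensor Y (d t.1.1) t.1.2.1)
    (d₂ := fun t => (√(-(a * t.1.2.2 - b)) : ℂ) • pureTensor Y (e t.1.1) t.1.2.1)
    (d₃ := fun t => pureTensor Y (f t.1.1) t.1.2.1) ?_ ?_
  · rintro ⟨⟨s, F, μ⟩, hμ, hF⟩ ⟨⟨t, K, ν⟩, hν, hK⟩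
    have h1 := sqrt_mul_sqrt_mul_inner hL hF hK (g := fun x => a * x - b) hμ
    have h2 := hf s t
    dsimp only at h1 ⊢
    rw [inner_separatedMap_eigenvector, inner_smul_left, inner_smul_right, Complex.conj_ofReal]
    simp only [inner_pureTensor, hk, hw]
    linear_combination ⟪F, K⟫_ℂ * h2 + ⟪e s, e t⟫_ℂ * h1
  · refine dense_of_pureTensor_mem hj hs fun s F ⟨μ, hμ, hF⟩ =>
      Submodule.subset_span ⟨⟨(s, F, μ), hμ, hF⟩, rfl⟩

end SeparatedOperator

/-! ### Application to the Hamilton operator. -/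

section Hamiltonian

variable {m : ℕ} {S : Type*} [TopologicalSpace S] [ChartedSpace (EuclideanSpace ℝ (Fin m)) S]
  [IsManifold (𝓡 m) ∞ S] [T2Space S] [CompactSpace S] [MeasurableSpace S]

/-- `𝓗₀` is a span taken in `L²(S, ℂ)`; here the same eigenvectors, as elements of `𝓗₀`, span it as
a space of its own. -/
theorem span_eigenvectors (G : Metric m S) (n : ℕ) (αM : ℝ) :
    Submodule.span ℂ {F : H0 G n αM | ∃ μ : ℝ,
      4 / (n : ℝ) ^ 2 * a0 n αM * μ - ((m : ℝ) - 1) ^ 2 / 4 ≤ 0 ∧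
        IsLaplacianOf G ((-(μ : ℂ) • F : H0 G n αM) : L2Matter G) (F : L2Matter G)} = ⊤ := by
  refine top_le_iff.1 (le_trans (le_of_eq (Submodule.span_span_coe_preimage (R := ℂ)
    (s := {F : L2Matter G | ∃ μ : ℝ, muBar m n αM μ ≤ 0 ∧
    ∃ f : S → ℂ, HasLaplacian G f (fun y => -((μ : ℂ) * f y)) ∧
      F =ᵐ[riemannianVolume G] f})).symm) (Submodule.span_mono ?_))
  rintro ⟨F, hF'⟩ ⟨μ, hμ, f, hf, hF⟩
  refine ⟨μ, hμ, f, _, hf, hF, ?_⟩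
  refine (Lp.coeFn_smul (-(μ : ℂ)) F).trans ?_
  filter_upwards [hF] with y hy
  rw [Pi.smul_apply, hy, smul_eq_mul, neg_mul]

theorem inner_laplacian_H0 [BorelSpace S] {G : Metric m S} {n : ℕ} {αM : ℝ}
    {K F K' F' : H0 G n αM} (h : IsLaplacianOf G (K : L2Matter G) (F : L2Matter G))
    (h' : IsLaplacianOf G (K' : L2Matter G) (F' : L2Matter G)) : ⟪K, F'⟫_ℂ = ⟪F, K'⟫_ℂ :=
  inner_laplacian h h'

theorem hamiltonianGraph_eq (G : Metric m S) (n : ℕ) (αM V Λ κ : ℝ) (I : Set ℝ) :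
    hamiltonianGraph G n αM V Λ κ I = Submodule.span ℂ
      {p : StateSpace G n αM I × StateSpace G n αM I | ∃ (u : TestFn I) (F K : H0 G n αM),
        IsLaplacianOf G (K : L2Matter G) (F : L2Matter G) ∧
        p.1 = pureTensor (H0 G n αM) (TestFn.toL2 I u) F ∧
        p.2 = separatedMap (H0 G n αM) (TestFn.toL2 I (TestFn.radialKinetic I u))
          (TestFn.toL2 I (TestFn.rpowMul I (-2) u)) (TestFn.toL2 I (TestFn.rpowMul I 2 u))
          (TestFn.toL2 I (TestFn.rpowMul I (2 * ((n : ℝ) - 2) / n) u))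
          ((4 / (n : ℝ) ^ 2 * a0 n αM : ℝ) : ℂ) ((((m : ℝ) - 1) ^ 2 / 4 : ℝ) : ℂ)
          ((16 / (n : ℝ) ^ 2 * (VBar n αM V + LambdaBar n Λ) : ℝ) : ℂ)
          ((16 / (n : ℝ) ^ 2 * κ : ℝ) : ℂ) (F, K)} := by
  have h1 : ((4 / (n : ℝ) ^ 2 * a0 n αM : ℝ) : ℂ) = 4 / (n : ℂ) ^ 2 * (a0 n αM : ℂ) := by
    push_cast; rfl
  have h2 : ((((m : ℝ) - 1) ^ 2 / 4 : ℝ) : ℂ) = ((m : ℂ) - 1) ^ 2 / 4 := by push_cast; rfl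
  have h3 : ((16 / (n : ℝ) ^ 2 * (VBar n αM V + LambdaBar n Λ) : ℝ) : ℂ)
      = 16 / (n : ℂ) ^ 2 * ((VBar n αM V + LambdaBar n Λ : ℝ) : ℂ) := by
    push_cast; rfl
  have h4 : ((16 / (n : ℝ) ^ 2 * κ : ℝ) : ℂ) = 16 / (n : ℂ) ^ 2 * (κ : ℂ) := by push_cast; rfl
  rw [h1, h2, h3, h4]
  rfl

/-- All the analysis is gathered here, leaving an upper bound on the potential as the only condition
on `V`, `Λ`, `κ` and `I`. -/
theorem hamiltonianSelfAdjoint_of_potential_le [BorelSpace S] (G : Metric m S) {n : ℕ} (hn : 2 ≤ n)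
    (αM V Λ κ : ℝ) {I : Set ℝ} (hI : IsOpen I) (hpos : I ⊆ Ioi 0)
    (hc : ∃ c : ℝ, ∀ r ∈ I, 16 / (n : ℝ) ^ 2 * (VBar n αM V + LambdaBar n Λ) * r ^ (2 : ℝ)
      - 16 / (n : ℝ) ^ 2 * κ * r ^ (2 * ((n : ℝ) - 2) / n) ≤ c) :
    HamiltonianSelfAdjoint G n αM V Λ κ I := by
  obtain ⟨c, hc⟩ := hc
  have hn' : (2 : ℝ) ≤ n := by exact_mod_cast hn
  have hp : 0 ≤ 2 * ((n : ℝ) - 2) / n := by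
    apply div_nonneg <;> linarith
  obtain ⟨f, hf⟩ := inner_potential hI hp hc
  rw [HamiltonianSelfAdjoint, hamiltonianGraph_eq]
  exact isSelfAdjointInFriedrichsSense_separated
    (L := fun K F : H0 G n αM => IsLaplacianOf G (K : L2Matter G) (F : L2Matter G))
    inner_laplacian_H0 (span_eigenvectors G n αM) (denseRange_toL2 hI hpos)
    inner_radialKinetic (inner_rpowMul_neg_two hI hpos) hf

end Hamiltonian

end FriedmanQC

theorem theorem1p4 {m : ℕ} (hm : 1 ≤ m) {S : Type*} [TopologicalSpace S]
    [ChartedSpace (EuclideanSpace ℝ (Fin m)) S] [IsManifold (𝓡 m) ∞ S] [T2Space S]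
    [CompactSpace S] [MeasurableSpace S] [BorelSpace S] (G : FriedmanQC.Metric m S)
    (n : ℕ) (hn : 2 ≤ n) (αM : ℝ) (hαM : 0 < αM) (V Λ κ : ℝ) :
    (∀ r₀ : ℝ, 0 < r₀ →
      FriedmanQC.HamiltonianSelfAdjoint G n αM V Λ κ (Ioo 0 r₀)) ∧
    ((FriedmanQC.VBar n αM V + FriedmanQC.LambdaBar n Λ ≤ 0 ∧ 0 ≤ κ) ∨
        FriedmanQC.VBar n αM V + FriedmanQC.LambdaBar n Λ < 0 →
      FriedmanQC.HamiltonianSelfAdjoint G n αM V Λ κ (Ioi 0)) := by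
  have hn' : (2 : ℝ) ≤ n := by exact_mod_cast hn
  have h16 : 0 < 16 / (n : ℝ) ^ 2 := by positivity
  have hp : 0 ≤ 2 * ((n : ℝ) - 2) / n := by
    apply div_nonneg <;> linarith
  -- The exponent equals `2 - 4/n`, so the `r²` term dominates at infinity whatever the sign of `κ`.
  have hp2 : 2 * ((n : ℝ) - 2) / n < 2 := by
    rw [div_lt_iff₀ (by linarith)]
    linarith
  refine ⟨fun r₀ _ => ?_, fun h => ?_⟩
  · exact FriedmanQC.hamiltonianSelfAdjoint_of_potential_le G hn αM V Λ κ isOpen_Ioo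
      (fun r hr => hr.1) (FriedmanQC.exists_potential_le_of_bounded _ _ _ r₀ hp)
  · refine FriedmanQC.hamiltonianSelfAdjoint_of_potential_le G hn αM V Λ κ isOpen_Ioi
      (fun r hr => hr) ?_
    rcases h with ⟨h1, h2⟩ | h
    · exact ⟨0, fun r hr => FriedmanQC.potential_nonpos hr
        (mul_nonpos_of_nonneg_of_nonpos h16.le h1) (mul_nonneg h16.le h2)⟩
    · exact FriedmanQC.exists_potential_le_of_neg _ _ _ hp hp2 (mul_neg_of_pos_of_neg h16 h)
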